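/- **Calculus.** Data values are $\bot,0,1,2,\dots$, pairs and finite sets of data values. Fix $n\ge 1$; locations are the wrapper $\star$ and the agents $1,\dots,n$. Expressions $e$ are built from data values, variables, pairing and functions, with value $[\![e]\!]$. Guarded processes are $\mathbf 0$, $\bar c\langle e\rangle.P$, $c(X).P$, $\mathrm{susp}\,k.P$, $\mathrm{psusp}\,k.P$, $G+G'$ and $\mathsf{if}\ e\ \mathsf{then}\ P\ \mathsf{else}\ Q$. Processes are guarded processes, $\tau.P$, calls $K(e)$ and $P\,|\,Q$. Networks are $\mathbf 0$, $\ell[P]$, $M\,\|\,N$ and $M\setminus a$. Channel names may carry indices, and these and $k$ may be given by expressions. A configuration $\langle\Gamma,t,M\rangle$ consists of $\Gamma=(L,m)$ with $L$ the set of live agents and $m$ the number of agents that may still crash, a trusted immortal $t$ (an agent, or $\bot$ if not yet chosen), and a network $M$. The wrapper is always live. We write $\bar c\langle e\rangle$ for $\bar c\langle e\rangle.\mathbf 0$, and $c(x)/i.P$ for $c(x).P+\mathrm{susp}\,i.P\{\bot/x\}$. Evaluation $>$, for $t\ne\bot$, is closed under parallel composition and restriction and generated by: $\ell[P|Q]>\ell[P]\,\|\,\ell[Q]$,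 $\ \ell[\mathbf 0]>\mathbf 0$, $\ \ell[\bar c\langle e\rangle.P]>\ell[\bar c\langle[\![e]\!]\rangle.P]$, $\ \ell[K(e)]>\ell[P\{[\![e]\!]/X\}]$ for an equation $K(X)=P$, $\ \ell[\mathsf{if}\ e\ \mathsf{then}\ P\ \mathsf{else}\ Q]>\ell[P]$ if $[\![e]\!]>0$ and $>\ell[Q]$ if $[\![e]\!]=0$ (all for live $\ell$); $\ \ell[P]>\mathbf 0$ for $\ell$ not live; $\ \mathbf 0\,\|\,N>N$ and $N\,\|\,\mathbf 0>N$. Structural congruence $\equiv$ (between configurations with the same $\Gamma,t$) is the least equivalence containing $>$ and the commutative monoid laws of $(\|,\mathbf 0)$ and closed under parallel composition and restriction. Transitions $\xrightarrow{\alpha}$ with $\alpha\in\{\tau,\ \bar c\langle v\rangle,\ c(v)\}$ are the least relation such that: if $t=\bot$, any $t'\in L$ may be chosen as the immortal ($\tau$). All other rules except the last need $t\neq\bot$, and keep $\Gamma$ unless stated: an agent $p\in L$, $p\ne t$, may crash if $m>0$, for any network, which turns $\Gamma$ into $(L\setminus\{p\},m-1)$ ($\tau$). For live $\ell$: $\ell[\mathrm{psusp}\,k.P]\xrightarrow{\tau}\ell[P]$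 if $k$ is not live; $\ell[\mathrm{susp}\,k.P]\xrightarrow{\tau}\ell[P]$ if $k\ne t,\ k\neq\ell$; $\ell[\tau.P]\xrightarrow{\tau}\ell[P]$; $\ell[\bar c\langle v\rangle]\xrightarrow{\bar c\langle v\rangle}\mathbf 0$; $\ell[c(X).P]\xrightarrow{c(v)}\ell[P\{v/X\}]$; and $\ell[G_1+G_2]\xrightarrow{\alpha}\ell[P]$ whenever $\ell[G_1]\xrightarrow{\alpha}\ell[P]$ or $\ell[G_2]\xrightarrow{\alpha}\ell[P]$ with $\Gamma$ unchanged. $M\,\|\,N$ inherits the transitions of $M$, and $M\setminus a$ those transitions of $M$ whose label is not on $a$ (both including changes of $\Gamma$); complementary visible transitions of $M$ and $N$ under the same $\Gamma$ give a $\tau$-transition of $M\,\|\,N$. Transitions are closed under $\equiv$ on both sides. **Algorithm.** For each agent $p$: - $\mathsf{P1}_p(r,V,W,M)=\mathsf{if}\ r<n\ \mathsf{then}\ \prod_{i=1}^n\overline{a_{p,i,r}}\langle W\rangle\,|\,\mathsf{C1}_p(r,V,M,1)\ \mathsf{else}\ \mathsf{P2}_p(V,M)$; - $\mathsf{C1}_p(r,V,M,i)=\mathsf{if}\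 i\le n\ \mathsf{then}\ a_{i,p,r}(W)/i.\,\mathsf{C1}_p(r,V,M\cup\{(W,r,i)\},i+1)$ $\mathsf{else}\ \mathsf{P1}_p(r+1,\mathrm{upd}_K(r,M,V),\mathrm{upd}_R(r,M,V),M)$; - $\mathsf{P2}_p(V,M)=\prod_{i=1}^n\overline{b_{p,i}}\langle V\rangle\,|\,\mathsf{C2}_p(V,M,1)$; - $\mathsf{C2}_p(V,M,i)=\mathsf{if}\ i\le n\ \mathsf{then}\ b_{i,p}(V')/i.\,\mathsf{C2}_p(V,M\cup\{(V',i)\},i+1)$ $\mathsf{else}\ \mathsf{P3}_p(\mathrm{correct}(M,V))$; - $\mathsf{P3}_p(V)=\overline{c_p}\langle\mathrm{getfst}(V)\rangle$; and $\mathsf{WRAP}(i,v,b)$ is: if $b\ne 1$, then $\mathsf{WRAP}(i,v,0)$; if $b=1$ and $1\le i\le n$, then $\mathrm{psusp}\,i.\mathsf{WRAP}(i+1,v,1)+c_i(v').\,\mathsf{if}\ (v=\bot\wedge v'\ne\bot)\vee v=v'\ \mathsf{then}\ \mathsf{WRAP}(i+1,v',1)\ \mathsf{else}\ \mathsf{WRAP}(i,v,0)$;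 if $b=1$ and $i=n+1$, then $\overline{ok}\langle\bot\rangle$; otherwise $\mathbf 0$. Here $V$ is a vector of $n$ pairs (value, round) and $W$ a vector of $n$ values; in both an unknown value is $\bot$. $\mathrm{upd}_K$ enters, with round $r$, each value unknown in $V$ that occurs in a replay vector of round $r$ in $M$; $\mathrm{upd}_R$ is the vector of exactly these newly learned values; $\mathrm{correct}$ resets to $(\bot,0)$ each entry of $V$ whose value is unknown in some knowledge vector received in phase 2; $\mathrm{getfst}$ is the first known value of $V$. Let $R$ consist of all $a_{p,i,r}$ ($1\le r<n$), $b_{p,i}$ and $c_p$. The initial configuration for proposals $u_1,\dots,u_n\in\mathbb N$ is $$\Big\langle(\{1,\dots,n\},n-1),\ \bot,\ \Big(\prod_{p=1}^n p[\mathsf{P1}_p(1,V^0_p,W^0_p,\emptyset)]\ \big\|\ \star[\mathsf{WRAP}(1,\bot,1)]\Big)\setminus R\Big\rangle,$$ where $V^0_p$ has $(u_p,0)$ at position $p$ and $(\bot,0)$ elsewhere, and $W^0_p$ has $u_p$ at position $p$ and $\bot$ elsewhere. A configuration is *reachable* if its trusted immortal is chosen and it is reached from some initial configuration by finitely many transitions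 (silent or visible). **Lemma.** For every $n\ge1$, every reachable configuration $\langle\Gamma,t,M\rangle$ has a normal form: there are finite sets $O_1$ of triples (agent, agent, number), $O_2$ of pairs of agents, $O_3$ of agents, $A_1$ of pairs (agent, number), $A_2$ of agents, data values $W_{p,r},V^1_p,M^1_p,V^2_p,M^2_p,V^3_p,w$ and natural numbers $I^1_p,I^2_p,j,b$ such that $\langle\Gamma,t,M\rangle\equiv\langle\Gamma,t,N\setminus R\rangle$ with $$\begin{aligned}N=\ &\prod_{(p,i,r)\in O_1}p[\overline{a_{p,i,r}}\langle W_{p,r}\rangle]\ \Big\|\prod_{(p,i)\in O_2}p[\overline{b_{p,i}}\langle V^2_p\rangle]\ \Big\|\prod_{p\in O_3}p[\overline{c_p}\langle V^3_p\rangle]\\ &\Big\|\prod_{(p,r)\in A_1}p[\mathsf{C1}_p(r,V^1_p,M^1_p,I^1_p)]\ \Big\|\prod_{p\in A_2}p[\mathsf{C2}_p(V^2_p,M^2_p,I^2_p)]\ \Big\|\ \star[\mathsf{WRAP}(j,w,b)],\end{aligned}$$ where every agent $p$ occurring as a location is live in $\Gamma$, $r<n$ for every $r$ that occurs, $I^1_p\le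 n$ and $I^2_p\le n$ for the agents occurring in $A_1$ and $A_2$ respectively, and either $j\le n$ and $b\in\{0,1\}$, or $j=n+1$ and $b=1$. -/

import Mathlib

namespace ConsensusCalculus

/-! ### Data values

Data values are built from `⊥` and the natural numbers by pairing and by forming finite sets.
Finite sets are enumerations, up to order and repetition, at every depth. -/

inductive PreValue : Type
  | bot : PreValue
  | num : ℕ → PreValue
  | pair : PreValue → PreValue → PreValue
  | set : List PreValue → PreValue

/-- The least congruence that identifies two enumerations of the same finite set. -/
inductive PreValue.Eqv : PreValue → PreValue → Prop
  | refl (a) : Eqv a a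
  | symm {a b} : Eqv a b → Eqv b a
  | trans {a b c} : Eqv a b → Eqv b c → Eqv a c
  | pair {a a' b b'} : Eqv a a' → Eqv b b' → Eqv (.pair a b) (.pair a' b')
  | cons {x y l l'} : Eqv x y → Eqv (.set l) (.set l') → Eqv (.set (x :: l)) (.set (y :: l'))
  | swap (x y l) : Eqv (.set (x :: y :: l)) (.set (y :: x :: l))
  | dup (x l) : Eqv (.set (x :: x :: l)) (.set (x :: l))

def Value : Type := Quot PreValue.Eqv

namespace Value

def bot : Value := Quot.mk _ .bot

def num (k : ℕ) : Value := Quot.mk _ (.num k)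

def empty : Value := Quot.mk _ (.set [])

def pair (a b : Value) : Value :=
  Quot.map₂ PreValue.pair (fun a _ _ h => .pair (.refl a) h) (fun _ _ b h => .pair h (.refl b)) a b

/-- The elements of an enumeration (none if the value is not a set). -/
def _root_.ConsensusCalculus.PreValue.elems : PreValue → List PreValue
  | .set l => l
  | _ => []

theorem _root_.ConsensusCalculus.PreValue.Eqv.elems {a b : PreValue} (h : PreValue.Eqv a b) :
    PreValue.Eqv (.set a.elems) (.set b.elems) := by
  induction h with
  | refl a => exact .refl _
  | symm _ ih => exact .symm ih
  | trans _ _ ih ih' => exact .trans ih ih'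
  | pair _ _ _ _ => exact .refl _
  | cons h h' _ _ => exact .cons h h'
  | swap x y l => exact .swap x y l
  | dup x l => exact .dup x l

/-- `insert x s` is `s ∪ {x}` for a finite set `s` (and `{x}` if `s` is not a set). -/
def insert (x s : Value) : Value :=
  Quot.map₂ (fun x s => PreValue.set (x :: s.elems))
    (fun x _ _ h => .cons (.refl x) h.elems) (fun _ _ _ h => .cons h (.refl _)) x s

/-- `x` is an element of the finite set `s`. -/
def Mem (x s : Value) : Prop := ∃ t, s = insert x t

/-- The number that a value is, if it is one. -/
def asNum : Value → Option ℕ :=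
  Quot.lift (fun a => match a with | .num k => some k | _ => none) (by
    intro a b h
    induction h with
    | symm _ ih => exact ih.symm
    | trans _ _ ih ih' => exact ih.trans ih'
    | _ => rfl)

/-- The two components of a value, if it is a pair. -/
def asPair : Value → Option (Value × Value) :=
  Quot.lift (fun a => match a with
      | .pair x y => some (Quot.mk _ x, Quot.mk _ y)
      | _ => none) (by
    intro a b h
    induction h with
    | symm _ ih => exact ih.symm
    | trans _ _ ih ih' => exact ih.trans ih'
    | pair h h' _ _ => simp only [Quot.sound h, Quot.sound h']
    | _ => rfl)

@[simp] theorem asNum_num (k : ℕ) : (num k).asNum = some k := rfl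

@[simp] theorem asNum_bot : bot.asNum = none := rfl

@[simp] theorem asNum_pair (a b : Value) : (pair a b).asNum = none := by
  induction a using Quot.ind; induction b using Quot.ind; rfl

@[simp] theorem asPair_pair (a b : Value) : (pair a b).asPair = some (a, b) := by
  induction a using Quot.ind; induction b using Quot.ind; rfl

@[simp] theorem asPair_bot : bot.asPair = none := rfl

@[simp] theorem asPair_num (k : ℕ) : (num k).asPair = none := rfl

theorem num_inj {j k : ℕ} (h : num j = num k) : j = k := by
  simpa using congrArg asNum h

theorem pair_inj {a b a' b' : Value} (h : pair a b = pair a' b') : a = a' ∧ b = b' := by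
  simpa using congrArg asPair h

theorem bot_ne_num (k : ℕ) : bot ≠ num k := fun h => by simpa using congrArg asNum h

theorem bot_ne_pair (a b : Value) : bot ≠ pair a b := fun h => by simpa using congrArg asPair h

theorem num_ne_pair (k : ℕ) (a b : Value) : num k ≠ pair a b := fun h => by
  simpa using congrArg asPair h

/-- Total versions of the destructors, with a default value on arguments of the wrong kind. -/
def toNat (v : Value) : ℕ := v.asNum.getD 0

def fst (v : Value) : Value := (v.asPair.map Prod.fst).getD bot

def snd (v : Value) : Value := (v.asPair.map Prod.snd).getD bot

open Classical in
/-- Truth values are the numbers `1` and `0`. -/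
noncomputable def ofProp (p : Prop) : Value := if p then num 1 else num 0

/-- The vector `(f 1, …, f n)`, as a list built by pairing. -/
def vec (n : ℕ) (f : ℕ → Value) : Value :=
  ((List.range n).map fun k => f (k + 1)).foldr pair bot

/-- The `q`-th entry of a vector, `q = 1, …, n`. Every entry of `⊥` is `⊥`. -/
def entry (V : Value) (q : ℕ) : Value := (snd^[q - 1] V).fst

end Value

/-! ### Functions on values used by the algorithm

Knowledge vectors `V` have entries `(x, r)`, with `x` a proposed value or `⊥` and `r` the round in
which `x` was learned. Replay vectors `W` have entries `x`. In a set `M` of collected messages, the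
triple `(W, r, i) = (W, (r, i))` is the replay vector `W` that was received from agent `i` in round
`r`, and the pair `(V, i)` is the knowledge vector `V` that was received from agent `i` in the
second phase; the component `W` or `V` is `⊥` if agent `i` was suspected. -/

open Classical in
/-- The value of agent `q` contained in a replay vector of round `r` in `M`, or `⊥`. -/
noncomputable def learned (r M : Value) (q : ℕ) : Value :=
  if h : ∃ x, x ≠ Value.bot ∧ ∃ W i, Value.Mem (.pair W (.pair r i)) M ∧ W.entry q = x
  then h.choose else .bot

open Classical in
/-- The value of agent `q` that is newly learned from round `r`, or `⊥`. -/
noncomputable def fresh (r M V : Value) (q : ℕ) : Value :=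
  if (V.entry q).fst = .bot then learned r M q else .bot

open Classical in
/-- The knowledge vector `V` after the values learned in round `r` have been added. -/
noncomputable def updateK (n : ℕ) (r M V : Value) : Value :=
  .vec n fun q => if fresh r M V q = .bot then V.entry q else .pair (fresh r M V q) r

/-- The replay vector that contains exactly the values learned in round `r`. -/
noncomputable def updateR (n : ℕ) (r M V : Value) : Value := .vec n fun q => fresh r M V q

open Classical in
/-- The knowledge vector `V` after all entries that are unknown in some knowledge vector received
in the second phase have been removed. -/
noncomputable def correctK (n : ℕ) (M V : Value) : Value :=
  .vec n fun q =>
    if ∃ V' i, Value.Mem (.pair V' (.num i)) M ∧ V' ≠ .bot ∧ (V'.entry q).fst = .bot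
    then .pair .bot (.num 0) else V.entry q

open Classical in
/-- The first known value of a knowledge vector, or `⊥`. -/
noncomputable def getFst (n : ℕ) (V : Value) : Value :=
  (((List.range n).map fun k => (V.entry (k + 1)).fst).find? fun x => x ≠ Value.bot).getD .bot

/-! ### Terms of the calculus -/

/-- Function names. -/
inductive Fn : Type
  | lt | le | eq | and | or | not | succ | insert | updateK | updateR | correctK | getFst

/-- The function denoted by a function name, applied to the tuple of its arguments. -/
noncomputable def Fn.apply (n : ℕ) : Fn → Value → Value
  | .lt, v => .ofProp (v.fst.toNat < v.snd.toNat)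
  | .le, v => .ofProp (v.fst.toNat ≤ v.snd.toNat)
  | .eq, v => .ofProp (v.fst = v.snd)
  | .and, v => .ofProp (0 < v.fst.toNat ∧ 0 < v.snd.toNat)
  | .or, v => .ofProp (0 < v.fst.toNat ∨ 0 < v.snd.toNat)
  | .not, v => .ofProp (v.toNat = 0)
  | .succ, v => .num (v.toNat + 1)
  | .insert, v => .insert v.snd v.fst
  | .updateK, v => ConsensusCalculus.updateK n v.fst v.snd.fst v.snd.snd
  | .updateR, v => ConsensusCalculus.updateR n v.fst v.snd.fst v.snd.snd
  | .correctK, v => ConsensusCalculus.correctK n v.fst v.snd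
  | .getFst, v => ConsensusCalculus.getFst n v

/-- Variable names. -/
abbrev Var : Type := ℕ

inductive Pattern : Type
  | var : Var → Pattern
  | pair : Pattern → Pattern → Pattern

inductive Expr : Type
  | val : Value → Expr
  | var : Var → Expr
  | pair : Expr → Expr → Expr
  | app : Fn → Expr → Expr

/-- Evaluation of an expression; undefined if the expression contains a variable. -/
noncomputable def Expr.eval (n : ℕ) : Expr → Option Value
  | .val v => some v
  | .var _ => none
  | .pair e e' => (e.eval n).bind fun v => (e'.eval n).map fun v' => .pair v v'
  | .app f e => (e.eval n).map (f.apply n)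

/-- A substitution of data values for variables. -/
abbrev Subst : Type := Var → Option Value

def Pattern.vars : Pattern → List Var
  | .var x => [x]
  | .pair X Y => X.vars ++ Y.vars

/-- The substitution `{v/X}`; undefined if `v` does not have the shape of `X`. -/
def Pattern.matches : Pattern → Value → Option Subst
  | .var x, v => some fun y => if y = x then some v else none
  | .pair X Y, v => v.asPair.bind fun w =>
      (X.matches w.1).bind fun σ => (Y.matches w.2).map fun τ => fun y => (σ y).orElse fun _ => τ y

/-- The restriction of a substitution to the variables outside a binding pattern. -/
def Subst.erase (σ : Subst) (X : Pattern) : Subst := fun y => if y ∈ X.vars then none else σ y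

def Expr.subst (σ : Subst) : Expr → Expr
  | .val v => .val v
  | .var x => match σ x with
    | some v => .val v
    | none => .var x
  | .pair e e' => .pair (e.subst σ) (e'.subst σ)
  | .app f e => .app f (e.subst σ)

/-- The symbols from which channel names are formed by indexing. -/
inductive ChanBase : Type
  | a | b | c | ok

/-- A channel name: a symbol together with its indices, such as `a_{p,i,r}`. -/
structure Channel : Type where
  base : ChanBase
  idx : List Value

/-- A channel name in a term; its indices may still contain variables. -/
structure ChanTerm : Type where
  base : ChanBase
  idx : List Expr

noncomputable def ChanTerm.eval (n : ℕ) (c : ChanTerm) : Option Channel :=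
  (c.idx.mapM (Expr.eval n)).map fun l => ⟨c.base, l⟩

def ChanTerm.subst (σ : Subst) (c : ChanTerm) : ChanTerm := ⟨c.base, c.idx.map (Expr.subst σ)⟩

/-- The `n` agents; the element `p` of `Fin n` is the agent with the number `p + 1`. -/
abbrev Agent (n : ℕ) : Type := Fin n

def Agent.number {n : ℕ} (p : Agent n) : ℕ := p.val + 1

/-- The locations: the wrapper and the agents. -/
inductive Loc (n : ℕ) : Type
  | wrap : Loc n
  | agent : Agent n → Loc n

/-- A location in a term: a location name, or an expression for the number of an agent. -/
inductive LocTerm (n : ℕ) : Type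
  | name : Loc n → LocTerm n
  | index : Expr → LocTerm n

def LocTerm.subst {n : ℕ} (σ : Subst) : LocTerm n → LocTerm n
  | .name l => .name l
  | .index e => .index (e.subst σ)

/-- The location that a location term denotes. -/
inductive LocTerm.Denotes {n : ℕ} : LocTerm n → Loc n → Prop
  | name (l : Loc n) : Denotes (.name l) l
  | index (e : Expr) (p : Agent n) (h : e.eval n = some (.num p.number)) :
      Denotes (.index e) (.agent p)

/-- The names of process constants: `P1_p, C1_p, P2_p, C2_p, P3_p` for each agent `p`, and
`WRAP`. -/
inductive Const (n : ℕ) : Type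
  | P1 : Agent n → Const n
  | C1 : Agent n → Const n
  | P2 : Agent n → Const n
  | C2 : Agent n → Const n
  | P3 : Agent n → Const n
  | WRAP : Const n

mutual
/-- Guarded processes. -/
inductive Guarded (n : ℕ) : Type
  | nil : Guarded n
  | out : ChanTerm → Expr → Proc n → Guarded n
  | inp : ChanTerm → Pattern → Proc n → Guarded n
  | susp : LocTerm n → Proc n → Guarded n
  | psusp : LocTerm n → Proc n → Guarded n
  | sum : Guarded n → Guarded n → Guarded n
  | ite : Expr → Proc n → Proc n → Guarded n
/-- Processes. -/
inductive Proc (n : ℕ) : Type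
  | tau : Proc n → Proc n
  | guarded : Guarded n → Proc n
  | call : Const n → Expr → Proc n
  | par : Proc n → Proc n → Proc n
end

mutual
def Guarded.subst {n : ℕ} (σ : Subst) : Guarded n → Guarded n
  | .nil => .nil
  | .out c e P => .out (c.subst σ) (e.subst σ) (P.subst σ)
  | .inp c X P => .inp (c.subst σ) X (P.subst (σ.erase X))
  | .susp k P => .susp (k.subst σ) (P.subst σ)
  | .psusp k P => .psusp (k.subst σ) (P.subst σ)
  | .sum G G' => .sum (G.subst σ) (G'.subst σ)
  | .ite e P Q => .ite (e.subst σ) (P.subst σ) (Q.subst σ)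
def Proc.subst {n : ℕ} (σ : Subst) : Proc n → Proc n
  | .tau P => .tau (P.subst σ)
  | .guarded G => .guarded (G.subst σ)
  | .call K e => .call K (e.subst σ)
  | .par P Q => .par (P.subst σ) (Q.subst σ)
end

/-- Networks. -/
inductive Net (n : ℕ) : Type
  | nil : Net n
  | loc : Loc n → Proc n → Net n
  | par : Net n → Net n → Net n
  | res : Net n → Channel → Net n

/-- The process equation `const(params) = body`. -/
structure ProcDef (n : ℕ) : Type where
  const : Const n
  params : Pattern
  body : Proc n

/-- The process `nil`. -/
def Proc.nil {n : ℕ} : Proc n := .guarded .nil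

/-- An output without continuation. -/
def Proc.send {n : ℕ} (c : ChanTerm) (e : Expr) : Proc n := .guarded (.out c e .nil)

def Proc.ite {n : ℕ} (e : Expr) (P Q : Proc n) : Proc n := .guarded (.ite e P Q)

/-- Input on `c` into `x`, or suspicion of `k`, in which case `x` is replaced by `⊥`. -/
def Guarded.inpOrSusp {n : ℕ} (c : ChanTerm) (x : Var) (k : LocTerm n) (P : Proc n) : Guarded n :=
  .sum (.inp c (.var x) P) (.susp k (P.subst fun y => if y = x then some .bot else none))

/-- Parallel composition of a list of processes. -/
def Proc.prod {n : ℕ} (l : List (Proc n)) : Proc n := l.foldr .par .nil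

/-- Parallel composition of a list of networks. -/
def Net.prod {n : ℕ} (l : List (Net n)) : Net n := l.foldr .par .nil

/-- Restriction of all channel names in a list. -/
def Net.resAll {n : ℕ} (M : Net n) (l : List Channel) : Net n := l.foldr (fun a N => .res N a) M

/-! ### Configurations, structural congruence and transitions -/

/-- The set of live agents and the number of agents that may still crash. -/
structure Env (n : ℕ) : Type where
  alive : Finset (Agent n)
  crashes : ℕ

/-- A configuration; `immortal` is the trusted immortal, or `none` if it is not yet chosen. -/
structure Config (n : ℕ) : Type where
  env : Env n
  immortal : Option (Agent n)
  net : Net n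

def Live {n : ℕ} (Γ : Env n) : Loc n → Prop
  | .wrap => True
  | .agent p => p ∈ Γ.alive

/-- Network evaluation `M > N` in the environment `Γ`, for the process equations `D`. -/
inductive NetEval {n : ℕ} (D : List (ProcDef n)) (Γ : Env n) : Net n → Net n → Prop
  | split {l P Q} : Live Γ l → NetEval D Γ (.loc l (.par P Q)) (.par (.loc l P) (.loc l Q))
  | nil {l} : Live Γ l → NetEval D Γ (.loc l .nil) .nil
  | dead {l P} : ¬ Live Γ l → NetEval D Γ (.loc l P) .nil
  | nil_par {N} : NetEval D Γ (.par .nil N) N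
  | par_nil {N} : NetEval D Γ (.par N .nil) N
  | out {l c e v P} : Live Γ l → Expr.eval n e = some v →
      NetEval D Γ (.loc l (.guarded (.out c e P))) (.loc l (.guarded (.out c (.val v) P)))
  | call {l K X P e v σ} : Live Γ l → (⟨K, X, P⟩ : ProcDef n) ∈ D → Expr.eval n e = some v →
      X.matches v = some σ → NetEval D Γ (.loc l (.call K e)) (.loc l (P.subst σ))
  | ite_true {l e k P Q} : Live Γ l → Expr.eval n e = some (.num k) → 0 < k →
      NetEval D Γ (.loc l (.guarded (.ite e P Q))) (.loc l P)
  | ite_false {l e P Q} : Live Γ l → Expr.eval n e = some (.num 0) →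
      NetEval D Γ (.loc l (.guarded (.ite e P Q))) (.loc l Q)
  | par_left {M M' N} : NetEval D Γ M M' → NetEval D Γ (.par M N) (.par M' N)
  | par_right {M N N'} : NetEval D Γ N N' → NetEval D Γ (.par M N) (.par M N')
  | res {M M' a} : NetEval D Γ M M' → NetEval D Γ (.res M a) (.res M' a)

/-- Structural congruence of networks in the environment `Γ` with trusted immortal `t`; network
evaluation is available once the trusted immortal is chosen. -/
inductive NetCong {n : ℕ} (D : List (ProcDef n)) (Γ : Env n) (t : Option (Agent n)) :
    Net n → Net n → Prop
  | eval {M N} : t ≠ none → NetEval D Γ M N → NetCong D Γ t M N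
  | refl (M) : NetCong D Γ t M M
  | symm {M N} : NetCong D Γ t M N → NetCong D Γ t N M
  | trans {M N O} : NetCong D Γ t M N → NetCong D Γ t N O → NetCong D Γ t M O
  | comm (M N) : NetCong D Γ t (.par M N) (.par N M)
  | assoc (M N O) : NetCong D Γ t (.par (.par M N) O) (.par M (.par N O))
  | unit (M) : NetCong D Γ t (.par M .nil) M
  | par {M M'} (N) : NetCong D Γ t M M' → NetCong D Γ t (.par M N) (.par M' N)
  | res {M M'} (a) : NetCong D Γ t M M' → NetCong D Γ t (.res M a) (.res M' a)

/-- Structural congruence of configurations. -/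
def StructCong {n : ℕ} (D : List (ProcDef n)) (C C' : Config n) : Prop :=
  C.env = C'.env ∧ C.immortal = C'.immortal ∧ NetCong D C.env C.immortal C.net C'.net

inductive Act : Type
  | tau : Act
  | out : Channel → Value → Act
  | inp : Channel → Value → Act

def Act.co : Act → Act
  | .tau => .tau
  | .out c v => .inp c v
  | .inp c v => .out c v

/-- The labelled transition relation. -/
inductive Step {n : ℕ} (D : List (ProcDef n)) : Config n → Act → Config n → Prop
  | ti {L k t M} : t ∈ L → Step D ⟨⟨L, k⟩, none, M⟩ .tau ⟨⟨L, k⟩, some t, M⟩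
  | crash {L k t p M} : p ≠ t → p ∈ L →
      Step D ⟨⟨L, k + 1⟩, some t, M⟩ .tau ⟨⟨L.erase p, k⟩, some t, M⟩
  | psusp {Γ t l k m P} : Live Γ l → LocTerm.Denotes k m → ¬ Live Γ m →
      Step D ⟨Γ, some t, .loc l (.guarded (.psusp k P))⟩ .tau ⟨Γ, some t, .loc l P⟩
  | susp {Γ t l k m P} : Live Γ l → LocTerm.Denotes k m → m ≠ .agent t → m ≠ l →
      Step D ⟨Γ, some t, .loc l (.guarded (.susp k P))⟩ .tau ⟨Γ, some t, .loc l P⟩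
  | tau {Γ t l P} : Live Γ l →
      Step D ⟨Γ, some t, .loc l (.tau P)⟩ .tau ⟨Γ, some t, .loc l P⟩
  | sum_left {Γ t l G G' α P} : Live Γ l →
      Step D ⟨Γ, some t, .loc l (.guarded G)⟩ α ⟨Γ, some t, .loc l P⟩ →
      Step D ⟨Γ, some t, .loc l (.guarded (.sum G G'))⟩ α ⟨Γ, some t, .loc l P⟩
  | sum_right {Γ t l G G' α P} : Live Γ l →
      Step D ⟨Γ, some t, .loc l (.guarded G')⟩ α ⟨Γ, some t, .loc l P⟩ →
      Step D ⟨Γ, some t, .loc l (.guarded (.sum G G'))⟩ α ⟨Γ, some t, .loc l P⟩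
  | par {Γ Γ' t M M' N α} : Step D ⟨Γ, some t, M⟩ α ⟨Γ', some t, M'⟩ →
      Step D ⟨Γ, some t, .par M N⟩ α ⟨Γ', some t, .par M' N⟩
  | snd {Γ t l ch c v} : Live Γ l → ChanTerm.eval n ch = some c →
      Step D ⟨Γ, some t, .loc l (.send ch (.val v))⟩ (.out c v) ⟨Γ, some t, .nil⟩
  | rcv {Γ t l ch c X P v σ} : Live Γ l → ChanTerm.eval n ch = some c → X.matches v = some σ →
      Step D ⟨Γ, some t, .loc l (.guarded (.inp ch X P))⟩ (.inp c v)
        ⟨Γ, some t, .loc l (P.subst σ)⟩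
  | com {Γ t M M' N N' α} : α ≠ .tau →
      Step D ⟨Γ, some t, M⟩ α ⟨Γ, some t, M'⟩ → Step D ⟨Γ, some t, N⟩ α.co ⟨Γ, some t, N'⟩ →
      Step D ⟨Γ, some t, .par M N⟩ .tau ⟨Γ, some t, .par M' N'⟩
  | red {C C₁ C₂ C' α} : StructCong D C C₁ → Step D C₁ α C₂ → StructCong D C₂ C' → Step D C α C'
  | res {Γ Γ' t M M' a α} : (∀ v, α ≠ .out a v) → (∀ v, α ≠ .inp a v) →
      Step D ⟨Γ, some t, M⟩ α ⟨Γ', some t, M'⟩ →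
      Step D ⟨Γ, some t, .res M a⟩ α ⟨Γ', some t, .res M' a⟩

/-- The reflexive and transitive closure of the silent transitions. -/
def WeakTau {n : ℕ} (D : List (ProcDef n)) : Config n → Config n → Prop :=
  Relation.ReflTransGen fun C C' => Step D C .tau C'

/-- The weak transition with label `α`. -/
def Weak {n : ℕ} (D : List (ProcDef n)) (α : Act) (C C' : Config n) : Prop :=
  (α = .tau ∧ WeakTau D C C') ∨
    (α ≠ .tau ∧ ∃ C₁ C₂, WeakTau D C C₁ ∧ Step D C₁ α C₂ ∧ WeakTau D C₂ C')

/-- The weak transition with a sequence of labels. -/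
def WeakSeq {n : ℕ} (D : List (ProcDef n)) : List Act → Config n → Config n → Prop
  | [], C, C' => WeakTau D C C'
  | α :: σ, C, C' => ∃ C₁, Weak D α C C₁ ∧ WeakSeq D σ C₁ C'

/-! ### The encoding of the algorithm -/

/-- A natural number as an expression. -/
def Expr.nat (k : ℕ) : Expr := .val (.num k)

/-- A binary function applied to two expressions. -/
def Expr.app₂ (f : Fn) (e e' : Expr) : Expr := .app f (.pair e e')

def Expr.tuple₃ (e₁ e₂ e₃ : Expr) : Expr := .pair e₁ (.pair e₂ e₃)

def Expr.tuple₄ (e₁ e₂ e₃ e₄ : Expr) : Expr := .pair e₁ (.pair e₂ (.pair e₃ e₄))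

/-- The channel `a_{p,i,r}` from agent `p` to agent `i` in round `r` of the first phase. -/
def chanA (p i r : Expr) : ChanTerm := ⟨.a, [p, i, r]⟩

/-- The channel `b_{p,i}` from agent `p` to agent `i` in the second phase. -/
def chanB (p i : Expr) : ChanTerm := ⟨.b, [p, i]⟩

/-- The channel `c_p` from agent `p` to the wrapper. -/
def chanC (p : Expr) : ChanTerm := ⟨.c, [p]⟩

def chanOk : ChanTerm := ⟨.ok, []⟩

/-- The variables `r`, `V`, `W`, `M`, `i`, `v`, `b` and the input variables of the encoding. -/
abbrev xr : Var := 0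
abbrev xV : Var := 1
abbrev xW : Var := 2
abbrev xM : Var := 3
abbrev xi : Var := 4
abbrev xv : Var := 5
abbrev xb : Var := 6
abbrev xV' : Var := 7
abbrev xv' : Var := 8

/-- `P1_p(r, V, W, M)`: broadcast the replay vector in round `r`, or go on to the second phase. -/
def defP1 {n : ℕ} (p : Agent n) : ProcDef n where
  const := .P1 p
  params := .pair (.var xr) (.pair (.var xV) (.pair (.var xW) (.var xM)))
  body := .ite (.app₂ .lt (.var xr) (.nat n))
    (.par
      (.prod ((List.finRange n).map fun i : Agent n =>
        .send (chanA (.nat p.number) (.nat i.number) (.var xr)) (.var xW)))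
      (.call (.C1 p) (.tuple₄ (.var xr) (.var xV) (.var xM) (.nat 1))))
    (.call (.P2 p) (.pair (.var xV) (.var xM)))

/-- `C1_p(r, V, M, i)`: collect the messages of round `r`, next from agent `i`. -/
def defC1 {n : ℕ} (p : Agent n) : ProcDef n where
  const := .C1 p
  params := .pair (.var xr) (.pair (.var xV) (.pair (.var xM) (.var xi)))
  body := .ite (.app₂ .le (.var xi) (.nat n))
    (.guarded (.inpOrSusp (chanA (.var xi) (.nat p.number) (.var xr)) xW (.index (.var xi))
      (.call (.C1 p) (.tuple₄ (.var xr) (.var xV)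
        (.app₂ .insert (.var xM) (.tuple₃ (.var xW) (.var xr) (.var xi)))
        (.app .succ (.var xi))))))
    (.call (.P1 p) (.tuple₄ (.app .succ (.var xr))
      (.app .updateK (.tuple₃ (.var xr) (.var xM) (.var xV)))
      (.app .updateR (.tuple₃ (.var xr) (.var xM) (.var xV)))
      (.var xM)))

/-- `P2_p(V, M)`: broadcast the knowledge vector. -/
def defP2 {n : ℕ} (p : Agent n) : ProcDef n where
  const := .P2 p
  params := .pair (.var xV) (.var xM)
  body := .par
    (.prod ((List.finRange n).map fun i : Agent n =>
      .send (chanB (.nat p.number) (.nat i.number)) (.var xV)))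
    (.call (.C2 p) (.tuple₃ (.var xV) (.var xM) (.nat 1)))

/-- `C2_p(V, M, i)`: collect the messages of the second phase, next from agent `i`. -/
def defC2 {n : ℕ} (p : Agent n) : ProcDef n where
  const := .C2 p
  params := .pair (.var xV) (.pair (.var xM) (.var xi))
  body := .ite (.app₂ .le (.var xi) (.nat n))
    (.guarded (.inpOrSusp (chanB (.var xi) (.nat p.number)) xV' (.index (.var xi))
      (.call (.C2 p) (.tuple₃ (.var xV)
        (.app₂ .insert (.var xM) (.pair (.var xV') (.var xi)))
        (.app .succ (.var xi))))))
    (.call (.P3 p) (.app₂ .correctK (.var xM) (.var xV)))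

/-- `P3_p(V)`: send the decision to the wrapper. -/
def defP3 {n : ℕ} (p : Agent n) : ProcDef n where
  const := .P3 p
  params := .var xV
  body := .send (chanC (.nat p.number)) (.app .getFst (.var xV))

/-- `WRAP(i, v, b)`: check the decisions, next that of agent `i`. -/
def defWrap (n : ℕ) : ProcDef n where
  const := .WRAP
  params := .pair (.var xi) (.pair (.var xv) (.var xb))
  body := .ite (.app₂ .eq (.var xb) (.nat 1))
    (.ite (.app₂ .and (.app₂ .le (.nat 1) (.var xi)) (.app₂ .le (.var xi) (.nat n)))
      (.guarded (.sum
        (.psusp (.index (.var xi))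
          (.call .WRAP (.tuple₃ (.app .succ (.var xi)) (.var xv) (.nat 1))))
        (.inp (chanC (.var xi)) (.var xv')
          (.ite
            (.app₂ .or
              (.app₂ .and (.app₂ .eq (.var xv) (.val .bot))
                (.app .not (.app₂ .eq (.var xv') (.val .bot))))
              (.app₂ .eq (.var xv) (.var xv')))
            (.call .WRAP (.tuple₃ (.app .succ (.var xi)) (.var xv') (.nat 1)))
            (.call .WRAP (.tuple₃ (.var xi) (.var xv) (.nat 0)))))))
      (.ite (.app₂ .eq (.var xi) (.nat (n + 1))) (.send chanOk (.val .bot)) .nil))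
    (.call .WRAP (.tuple₃ (.var xi) (.var xv) (.nat 0)))

/-- The process equations of the encoding. -/
def defs (n : ℕ) : List (ProcDef n) :=
  defWrap n :: (List.finRange n).flatMap fun p => [defP1 p, defC1 p, defP2 p, defC2 p, defP3 p]

/-- The restricted names: all channels `a_{p,i,r}`, `b_{p,i}` and `c_p` of the algorithm. -/
def restricted (n : ℕ) : List Channel :=
  ((List.finRange n).flatMap fun p : Agent n => (List.finRange n).flatMap fun i : Agent n =>
    (List.range' 1 (n - 1)).map fun r => ⟨.a, [.num p.number, .num i.number, .num r]⟩) ++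
  ((List.finRange n).flatMap fun p : Agent n => (List.finRange n).map fun i : Agent n =>
    ⟨.b, [.num p.number, .num i.number]⟩) ++
  ((List.finRange n).map fun p : Agent n => ⟨.c, [.num p.number]⟩)

/-- The initial knowledge vector of agent `p`, who proposes `x`. -/
def initV {n : ℕ} (p : Agent n) (x : ℕ) : Value :=
  .vec n fun q => .pair (if q = p.number then .num x else .bot) (.num 0)

/-- The initial replay vector of agent `p`, who proposes `x`. -/
def initW {n : ℕ} (p : Agent n) (x : ℕ) : Value :=
  .vec n fun q => if q = p.number then .num x else .bot

/-- The wrapper `WRAP(j, w, b)` at its location. -/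
def wrapperNet (n j : ℕ) (w : Value) (b : ℕ) : Net n :=
  .loc .wrap (.call .WRAP (.tuple₃ (.nat j) (.val w) (.nat b)))

/-- The initial configuration for the proposed values `U`. -/
def initial (n : ℕ) (U : Agent n → ℕ) : Config n where
  env := ⟨Finset.univ, n - 1⟩
  immortal := none
  net := Net.resAll
    (.par
      (.prod ((List.finRange n).map fun p : Agent n => .loc (.agent p)
        (.call (.P1 p) (.tuple₄ (.nat 1) (.val (initV p (U p))) (.val (initW p (U p)))
          (.val .empty)))))
      (wrapperNet n 1 .bot 1))
    (restricted n)

/-- The configurations that are reachable from some initial configuration and in which the trusted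
immortal is chosen. -/
def Reachable (n : ℕ) (C : Config n) : Prop :=
  C.immortal ≠ none ∧ ∃ U : Agent n → ℕ, ∃ σ : List Act,
    (∀ α ∈ σ, α ≠ Act.tau) ∧ WeakSeq (defs n) σ (initial n U) C

/-! ### Normal forms -/

/-- The parameters of a normal form. -/
structure NFData (n : ℕ) : Type where
  /-- pending messages of the first phase (sender, receiver, round) -/
  out1 : Finset (Agent n × Agent n × ℕ)
  /-- pending messages of the second phase (sender, receiver) -/
  out2 : Finset (Agent n × Agent n)
  /-- pending messages of the third phase (sender) -/
  out3 : Finset (Agent n)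
  /-- agents that collect messages of the first phase, with their round -/
  col1 : Finset (Agent n × ℕ)
  /-- agents that collect messages of the second phase -/
  col2 : Finset (Agent n)
  W : Agent n → ℕ → Value
  V1 : Agent n → Value
  M1 : Agent n → Value
  I1 : Agent n → ℕ
  V2 : Agent n → Value
  M2 : Agent n → Value
  I2 : Agent n → ℕ
  V3 : Agent n → Value
  wj : ℕ
  ww : Value
  wb : ℕ

/-- The network with the given parameters. -/
noncomputable def NFData.net {n : ℕ} (F : NFData n) : Net n :=
  Net.resAll
    (.par (.prod (F.out1.toList.map fun x => .loc (.agent x.1)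
        (.send (chanA (.nat x.1.number) (.nat x.2.1.number) (.nat x.2.2))
          (.val (F.W x.1 x.2.2)))))
    (.par (.prod (F.out2.toList.map fun x => .loc (.agent x.1)
        (.send (chanB (.nat x.1.number) (.nat x.2.number)) (.val (F.V2 x.1)))))
    (.par (.prod (F.out3.toList.map fun p => .loc (.agent p)
        (.send (chanC (.nat p.number)) (.val (F.V3 p)))))
    (.par (.prod (F.col1.toList.map fun x => .loc (.agent x.1)
        (.call (.C1 x.1) (.tuple₄ (.nat x.2) (.val (F.V1 x.1)) (.val (F.M1 x.1))
          (.nat (F.I1 x.1))))))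
    (.par (.prod (F.col2.toList.map fun p => .loc (.agent p)
        (.call (.C2 p) (.tuple₃ (.val (F.V2 p)) (.val (F.M2 p)) (.nat (F.I2 p))))))
      (wrapperNet n F.wj F.ww F.wb))))))
    (restricted n)

/-- The side conditions on the parameters of a normal form in the environment `Γ`: all agents that
occur are live, and the numerical parameters are in their ranges. -/
structure NFData.Valid {n : ℕ} (F : NFData n) (Γ : Env n) : Prop where
  out1 : ∀ x ∈ F.out1, Live Γ (.agent x.1) ∧ x.2.2 < n
  out2 : ∀ x ∈ F.out2, Live Γ (.agent x.1)
  out3 : ∀ p ∈ F.out3, Live Γ (.agent p)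
  col1 : ∀ x ∈ F.col1, Live Γ (.agent x.1) ∧ x.2 < n ∧ F.I1 x.1 ≤ n
  col2 : ∀ p ∈ F.col2, Live Γ (.agent p) ∧ F.I2 p ≤ n
  wrap : (F.wj ≤ n ∧ F.wb ∈ ({0, 1} : Set ℕ)) ∨ (F.wj = n + 1 ∧ F.wb = 1)

/-- `N` is a normal form of `C`. -/
def IsNormalFormOf {n : ℕ} (N C : Config n) : Prop :=
  StructCong (defs n) N C ∧ ∃ F : NFData n, F.Valid N.env ∧ N.net = F.net

end ConsensusCalculus

namespace ConsensusCalculus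

/-! ### Evaluation of networks to multisets of threads -/

-- A network is described by the multiset of threads to which it evaluates: pending outputs, sums
-- waiting for an input or a suspicion, and the wrapper call that unfolds forever. Since `≡`
-- contains evaluation in both directions, a term can be rewritten backwards in arbitrary ways, and
-- its syntactic shape is of no use along transitions. The multiset is what survives, and three
-- facts about it carry the proof.
--
-- Soundness (`NetCong.den_iff`): congruent networks evaluate to the same multisets, below the same
-- list of restrictions, because `≡` never moves a restriction. The delicate equation is that of the
-- wrapper: for b ≠ 1 the call WRAP(i,v,b) unfolds to WRAP(i,v,0) without end. Such a call is
-- therefore itself counted as a thread, represented by WRAP(i,v,0).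
--
-- Completeness (`ResDen.netCong`): once the immortal is chosen, a network is congruent to the
-- product of its threads below its restrictions. Networks with equal threads and restrictions are
-- thus congruent.
--
-- Transitions (`Step.effect`): a transition chooses the immortal, or deletes the threads of dead
-- agents, or replaces one or two firing threads by the evaluation of what they become. Channels,
-- trust and the origin of received values are forgotten, since the normal form allows arbitrary
-- data.
--
-- It remains to see that having the threads of a normal form is an invariant. Validity alone is not
-- inductive: the parameters are shared, for example V²_p by the collector of p and its pending
-- messages, and the pending messages form sets, so a new round must not collide with an old one.
-- `Consistent` supplies what is missing: each agent is in one phase, and its pending messages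
-- belong to no later round. Firing is treated in `Good.fires`, crashes in `Good.survivors`, the
-- initial configuration in `exists_agents`; completeness turns the invariant into the required
-- congruence.

/-- The equation of a process constant. -/
def defOf {n : ℕ} : Const n → ProcDef n
  | .P1 p => defP1 p
  | .C1 p => defC1 p
  | .P2 p => defP2 p
  | .C2 p => defC2 p
  | .P3 p => defP3 p
  | .WRAP => defWrap n

theorem mem_defs {n : ℕ} {d : ProcDef n} : d ∈ defs n ↔ d = defOf d.const := by
  constructor
  · intro h
    simp only [defs, List.mem_cons, List.mem_flatMap, List.not_mem_nil, or_false] at h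
    rcases h with rfl | ⟨p, -, rfl | rfl | rfl | rfl | rfl⟩ <;> rfl
  · intro h
    generalize d.const = K at h
    subst h
    simp only [defs, List.mem_cons, List.mem_flatMap]
    cases K with
    | WRAP => exact .inl rfl
    | _ p => exact .inr ⟨p, List.mem_finRange p, by simp [defOf]⟩

theorem defOf_mem {n : ℕ} (K : Const n) : ⟨K, (defOf K).params, (defOf K).body⟩ ∈ defs n := by
  rw [mem_defs]; cases K <;> rfl

theorem eq_defOf {n : ℕ} {K : Const n} {X : Pattern} {P : Proc n}
    (h : (⟨K, X, P⟩ : ProcDef n) ∈ defs n) : X = (defOf K).params ∧ P = (defOf K).body := by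
  rw [mem_defs] at h
  exact ⟨congrArg ProcDef.params h, congrArg ProcDef.body h⟩

/-- A process running at a location. -/
abbrev Thread (n : ℕ) : Type := Loc n × Proc n

/-- Sums of inputs and suspicions. -/
inductive Waiting {n : ℕ} : Guarded n → Prop
  | inp (c X P) : Waiting (.inp c X P)
  | susp (k P) : Waiting (.susp k P)
  | psusp (k P) : Waiting (.psusp k P)
  | sum {G G'} : Waiting G → Waiting G' → Waiting (.sum G G')

/-- The call `K(v)` is a call of the wrapper that unfolds forever. -/
def Diverges {n : ℕ} (K : Const n) (v : Value) : Prop :=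
  K = .WRAP ∧ ∃ i w b, v = .pair i (.pair w b) ∧ b ≠ .num 1

/-- Evaluation of a located process to the multiset of its threads. A diverging call of the wrapper
counts as a thread. -/
inductive Runs {n : ℕ} (Γ : Env n) (l : Loc n) : Proc n → Multiset (Thread n) → Prop
  | dead {P} : ¬ Live Γ l → Runs Γ l P 0
  | nil : Live Γ l → Runs Γ l (.guarded .nil) 0
  | par {P Q S T} : Live Γ l → Runs Γ l P S → Runs Γ l Q T → Runs Γ l (.par P Q) (S + T)
  | out {c e v P} : Live Γ l → Expr.eval n e = some v →
      Runs Γ l (.guarded (.out c e P)) {(l, .guarded (.out c (.val v) P))}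
  | waiting {G} : Live Γ l → Waiting G → Runs Γ l (.guarded G) {(l, .guarded G)}
  | ite_true {e k P Q S} : Live Γ l → Expr.eval n e = some (.num k) → 0 < k →
      Runs Γ l P S → Runs Γ l (.guarded (.ite e P Q)) S
  | ite_false {e P Q S} : Live Γ l → Expr.eval n e = some (.num 0) →
      Runs Γ l Q S → Runs Γ l (.guarded (.ite e P Q)) S
  | call {K e v σ S} : Live Γ l → Expr.eval n e = some v → ¬ Diverges K v →
      (defOf K).params.matches v = some σ → Runs Γ l ((defOf K).body.subst σ) S →
      Runs Γ l (.call K e) S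
  | diverges {e i w b} : Live Γ l → Expr.eval n e = some (.pair i (.pair w b)) → b ≠ .num 1 →
      Runs Γ l (.call .WRAP e) {(l, .call .WRAP (.tuple₃ (.val i) (.val w) (.nat 0)))}

/-- Evaluation of a network without restrictions to the multiset of its threads. -/
inductive Den {n : ℕ} (Γ : Env n) : Net n → Multiset (Thread n) → Prop
  | nil : Den Γ .nil 0
  | loc {l P S} : Runs Γ l P S → Den Γ (.loc l P) S
  | par {M N S T} : Den Γ M S → Den Γ N T → Den Γ (.par M N) (S + T)

/-- Evaluation of a network whose threads all lie below the same nested restrictions. -/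
inductive ResDen {n : ℕ} (Γ : Env n) : List Channel → Net n → Multiset (Thread n) → Prop
  | flat {M S} : Den Γ M S → ResDen Γ [] M S
  | res {a l M S} : ResDen Γ l M S → ResDen Γ (a :: l) (.res M a) S
  | par_left {a l M N S} : ResDen Γ (a :: l) M S → Den Γ N 0 → ResDen Γ (a :: l) (.par M N) S
  | par_right {a l M N S} : Den Γ M 0 → ResDen Γ (a :: l) N S → ResDen Γ (a :: l) (.par M N) S

-- Inversion of the evaluation relations.

section Inversion

variable {n : ℕ} {Γ : Env n}

theorem den_nil {S : Multiset (Thread n)} : Den Γ .nil S ↔ S = 0 :=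
  ⟨fun h => by cases h; rfl, fun h => h ▸ .nil⟩

theorem den_loc {l : Loc n} {P : Proc n} {S : Multiset (Thread n)} :
    Den Γ (.loc l P) S ↔ Runs Γ l P S :=
  ⟨fun h => by cases h; assumption, .loc⟩

theorem den_par {M N : Net n} {S : Multiset (Thread n)} :
    Den Γ (.par M N) S ↔ ∃ S₁ S₂, S = S₁ + S₂ ∧ Den Γ M S₁ ∧ Den Γ N S₂ :=
  ⟨fun h => by cases h with | par h h' => exact ⟨_, _, rfl, h, h'⟩,
    fun ⟨_, _, e, h, h'⟩ => e ▸ .par h h'⟩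

theorem den_res {M : Net n} {a : Channel} {S : Multiset (Thread n)} : ¬ Den Γ (.res M a) S :=
  fun h => by cases h

theorem resDen_flat {M : Net n} {S : Multiset (Thread n)} : ResDen Γ [] M S ↔ Den Γ M S :=
  ⟨fun h => by cases h; assumption, .flat⟩

theorem resDen_nil {a : Channel} {l : List Channel} {S : Multiset (Thread n)} :
    ¬ ResDen Γ (a :: l) .nil S := fun h => by cases h

theorem resDen_loc {a : Channel} {l : List Channel} {k : Loc n} {P : Proc n}
    {S : Multiset (Thread n)} : ¬ ResDen Γ (a :: l) (.loc k P) S := fun h => by cases h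

theorem resDen_res {a b : Channel} {l : List Channel} {M : Net n} {S : Multiset (Thread n)} :
    ResDen Γ (a :: l) (.res M b) S ↔ a = b ∧ ResDen Γ l M S :=
  ⟨fun h => by cases h; exact ⟨rfl, by assumption⟩, fun ⟨e, h⟩ => e ▸ .res h⟩

theorem resDen_par {a : Channel} {l : List Channel} {M N : Net n} {S : Multiset (Thread n)} :
    ResDen Γ (a :: l) (.par M N) S ↔
      (ResDen Γ (a :: l) M S ∧ Den Γ N 0) ∨ (Den Γ M 0 ∧ ResDen Γ (a :: l) N S) := by
  constructor
  · intro h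
    cases h with
    | par_left h h' => exact .inl ⟨h, h'⟩
    | par_right h h' => exact .inr ⟨h, h'⟩
  · rintro (⟨h, h'⟩ | ⟨h, h'⟩)
    · exact .par_left h h'
    · exact .par_right h h'

theorem den_par_zero {M N : Net n} : Den Γ (.par M N) 0 ↔ Den Γ M 0 ∧ Den Γ N 0 := by
  rw [den_par]
  constructor
  · rintro ⟨S, T, e, h, h'⟩
    obtain ⟨rfl, rfl⟩ : S = 0 ∧ T = 0 := by
      simpa [eq_comm] using e
    exact ⟨h, h'⟩
  · rintro ⟨h, h'⟩
    exact ⟨0, 0, rfl, h, h'⟩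

end Inversion

/-! ### Invariance under structural congruence -/

section Invariance

variable {n : ℕ} {Γ : Env n}

/-- The equation of the wrapper with its parameters instantiated. -/
def wrapBody (n : ℕ) (i w b : Value) : Proc n :=
  .ite (.app₂ .eq (.val b) (.nat 1))
    (.ite (.app₂ .and (.app₂ .le (.nat 1) (.val i)) (.app₂ .le (.val i) (.nat n)))
      (.guarded (.sum
        (.psusp (.index (.val i))
          (.call .WRAP (.tuple₃ (.app .succ (.val i)) (.val w) (.nat 1))))
        (.inp (chanC (.val i)) (.var xv')
          (.ite
            (.app₂ .or
              (.app₂ .and (.app₂ .eq (.val w) (.val .bot))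
                (.app .not (.app₂ .eq (.var xv') (.val .bot))))
              (.app₂ .eq (.val w) (.var xv')))
            (.call .WRAP (.tuple₃ (.app .succ (.val i)) (.var xv') (.nat 1)))
            (.call .WRAP (.tuple₃ (.val i) (.val w) (.nat 0)))))))
      (.ite (.app₂ .eq (.val i) (.nat (n + 1))) (.send chanOk (.val .bot)) .nil))
    (.call .WRAP (.tuple₃ (.val i) (.val w) (.nat 0)))

/-- The matching substitution is an unwieldy function and only the instantiated body matters later,
so it is hidden behind an existential. -/
theorem exists_wrap_matches (n : ℕ) (i w b : Value) :
    ∃ σ, (defOf (.WRAP : Const n)).params.matches (.pair i (.pair w b)) = some σ ∧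
      (defOf (.WRAP : Const n)).body.subst σ = wrapBody n i w b := by
  refine ⟨_, by simp only [defOf, defWrap, Pattern.matches, Value.asPair_pair, Option.bind_some,
    Option.map_some]; rfl, ?_⟩
  simp [defOf, defWrap, wrapBody, Proc.ite, Proc.send, Proc.nil, Proc.subst, Guarded.subst,
    Expr.subst, Expr.app₂, Expr.tuple₃, Expr.nat, chanC, chanOk, ChanTerm.subst, LocTerm.subst,
    Subst.erase, Pattern.vars]

theorem eval_eq (n : ℕ) (v w : Value) :
    Expr.eval n (.app₂ .eq (.val v) (.val w)) = some (.ofProp (v = w)) := by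
  simp [Expr.app₂, Expr.eval, Fn.apply, Value.fst, Value.snd]

/-- For ordinary calls this is the rule `call` and its inversion. A diverging call of the wrapper
unfolds, through the false test b = 1, to WRAP(i,w,0), which diverges again and has the same
canonical thread. -/
theorem runs_call_iff {l : Loc n} (hl : Live Γ l) {K : Const n} {X : Pattern} {P : Proc n}
    {e : Expr} {v : Value} {σ : Subst} (hK : (⟨K, X, P⟩ : ProcDef n) ∈ defs n)
    (he : Expr.eval n e = some v) (hσ : X.matches v = some σ) {S : Multiset (Thread n)} :
    Runs Γ l (.call K e) S ↔ Runs Γ l (P.subst σ) S := by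
  obtain ⟨rfl, rfl⟩ := eq_defOf hK
  by_cases hd : Diverges K v
  · obtain ⟨rfl, i, w, b, rfl, hb⟩ := hd
    obtain ⟨τ, hτ, hbody⟩ := exists_wrap_matches n i w b
    obtain rfl : τ = σ := by rw [hσ] at hτ; exact (Option.some.inj hτ).symm
    rw [hbody]
    have hc : Expr.eval n (.app₂ .eq (.val b) (.nat 1)) = some (.num 0) := by
      rw [Expr.nat, eval_eq]; simp [Value.ofProp, hb]
    -- The canonical thread forgets the flag, so all diverging calls with the same i and w have this
    -- one evaluation.
    have key : ∀ {e' : Expr} {T : Multiset (Thread n)} {c : Value}, c ≠ .num 1 →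
        Expr.eval n e' = some (.pair i (.pair w c)) →
        (Runs Γ l (.call .WRAP e') T ↔
          T = {(l, .call .WRAP (.tuple₃ (.val i) (.val w) (.nat 0)))}) := by
      intro e' T c hc he'
      constructor
      · intro h
        cases h with
        | dead h => exact absurd hl h
        | call _ h1 h2 _ _ =>
          rw [he'] at h1
          cases h1
          exact absurd ⟨rfl, i, w, c, rfl, hc⟩ h2
        | diverges _ h1 _ =>
          rw [he'] at h1
          have h1 := Value.pair_inj (Option.some.inj h1)
          obtain ⟨rfl, rfl⟩ := h1.1, (Value.pair_inj h1.2).1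
          rfl
      · rintro rfl
        exact .diverges hl he' hc
    have h0 : Expr.eval n (.tuple₃ (.val i) (.val w) (.nat 0)) =
        some (.pair i (.pair w (.num 0))) := by
      simp [Expr.tuple₃, Expr.eval, Expr.nat]
    have h01 : Value.num 0 ≠ .num 1 := fun h => by simpa using Value.num_inj h
    rw [key hb he, ← key h01 h0]
    constructor
    · exact fun h => .ite_false hl hc h
    · intro h
      cases h with
      | dead h => exact absurd hl h
      | waiting _ h => cases h
      | ite_true _ h hk _ =>
        rw [hc] at h
        have := Value.num_inj (Option.some.inj h)
        omega
      | ite_false _ _ h => exact h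
  · constructor
    · intro h
      cases h with
      | dead h => exact absurd hl h
      | call _ h1 _ h2 h =>
        rw [he] at h1
        cases h1
        rw [hσ] at h2
        cases h2
        exact h
      | diverges _ h1 h2 =>
        rw [he] at h1
        cases h1
        exact absurd ⟨rfl, _, _, _, rfl, h2⟩ hd
    · exact fun h => .call hl he hd hσ h

/-- Each rule can be inverted: liveness, the syntax and the value of a guard decide how `Runs`
proceeds. The two clauses are proved together because removing the last restriction leads from the
second to the first. -/
theorem NetEval.den_iff {M N : Net n} (h : NetEval (defs n) Γ M N) :
    (∀ S, Den Γ M S ↔ Den Γ N S) ∧ ∀ a l S, ResDen Γ (a :: l) M S ↔ ResDen Γ (a :: l) N S := by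
  induction h with
  | split hl =>
    refine ⟨fun S => ?_, fun a l S => ?_⟩
    · simp only [den_par, den_loc]
      constructor
      · intro h
        cases h with
        | dead h => exact absurd hl h
        | par _ h h' => exact ⟨_, _, rfl, h, h'⟩
      · rintro ⟨S, T, rfl, h, h'⟩
        exact .par hl h h'
    · simp [resDen_par, resDen_loc]
  | nil hl =>
    refine ⟨fun S => ?_, fun a l S => by simp [resDen_nil, resDen_loc]⟩
    rw [den_nil, den_loc]
    constructor
    · intro h
      cases h with
      | dead _ => rfl
      | nil _ => rfl
      | waiting _ h => cases h
    · rintro rfl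
      exact .nil hl
  | dead hl =>
    refine ⟨fun S => ?_, fun a l S => by simp [resDen_nil, resDen_loc]⟩
    rw [den_nil, den_loc]
    constructor
    · intro h
      cases h with
      | dead _ => rfl
      | nil _ => rfl
      | par h _ _ => exact absurd h hl
      | out h _ => exact absurd h hl
      | waiting h _ => exact absurd h hl
      | ite_true h _ _ _ => exact absurd h hl
      | ite_false h _ _ => exact absurd h hl
      | call h _ _ _ _ => exact absurd h hl
      | diverges h _ _ => exact absurd h hl
    · rintro rfl
      exact .dead hl
  | nil_par => simp [den_par, den_nil, resDen_par, resDen_nil]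
  | par_nil => simp [den_par, den_nil, resDen_par, resDen_nil]
  | @out l c e v P hl he =>
    refine ⟨fun S => ?_, fun a l S => by simp [resDen_loc]⟩
    have key : ∀ e', Expr.eval n e' = some v → (Runs Γ l (.guarded (.out c e' P)) S ↔
        S = {(l, .guarded (.out c (.val v) P))}) := by
      intro e' he'
      constructor
      · intro h
        cases h with
        | dead h => exact absurd hl h
        | out _ h =>
          rw [he'] at h
          cases h
          rfl
        | waiting _ h => cases h
      · rintro rfl
        exact .out hl he'
    rw [den_loc, den_loc, key e he, key (.val v) rfl]
  | call hl hK he hσ =>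
    refine ⟨fun S => ?_, fun a l S => by simp [resDen_loc]⟩
    rw [den_loc, den_loc, runs_call_iff hl hK he hσ]
  | ite_true hl he hk =>
    refine ⟨fun S => ?_, fun a l S => by simp [resDen_loc]⟩
    rw [den_loc, den_loc]
    constructor
    · intro h
      cases h with
      | dead h => exact absurd hl h
      | waiting _ h => cases h
      | ite_true _ _ _ h => exact h
      | ite_false _ h _ =>
        rw [he] at h
        have := Value.num_inj (Option.some.inj h)
        omega
    · exact fun h => .ite_true hl he hk h
  | ite_false hl he =>
    refine ⟨fun S => ?_, fun a l S => by simp [resDen_loc]⟩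
    rw [den_loc, den_loc]
    constructor
    · intro h
      cases h with
      | dead h => exact absurd hl h
      | waiting _ h => cases h
      | ite_false _ _ h => exact h
      | ite_true _ h hk _ =>
        rw [he] at h
        have := Value.num_inj (Option.some.inj h)
        omega
    · exact fun h => .ite_false hl he h
  | par_left _ ih => simp [den_par, resDen_par, ih.1, ih.2]
  | par_right _ ih => simp [den_par, resDen_par, ih.1, ih.2]
  | @res M M' b _ ih =>
    refine ⟨fun S => by simp [den_res], fun a l S => ?_⟩
    rw [resDen_res, resDen_res]
    cases l with
    | nil => rw [resDen_flat, resDen_flat, ih.1]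
    | cons c l => rw [ih.2]

/-- Being an equivalence, the statement is indifferent to the direction of evaluation, so symmetry
of `≡` costs nothing. -/
theorem NetCong.den_iff {t : Option (Agent n)} {M N : Net n} (h : NetCong (defs n) Γ t M N) :
    (∀ S, Den Γ M S ↔ Den Γ N S) ∧ ∀ a l S, ResDen Γ (a :: l) M S ↔ ResDen Γ (a :: l) N S := by
  induction h with
  | eval _ h => exact h.den_iff
  | refl => simp
  | symm _ ih => exact ⟨fun S => (ih.1 S).symm, fun a l S => (ih.2 a l S).symm⟩
  | trans _ _ ih ih' =>
    exact ⟨fun S => (ih.1 S).trans (ih'.1 S), fun a l S => (ih.2 a l S).trans (ih'.2 a l S)⟩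
  | comm M N =>
    refine ⟨fun S => ?_, fun a l S => ?_⟩
    · rw [den_par, den_par]
      constructor <;> rintro ⟨S, T, rfl, h, h'⟩ <;> exact ⟨T, S, add_comm _ _, h', h⟩
    · rw [resDen_par, resDen_par]
      tauto
  | assoc M N O =>
    refine ⟨fun S => ?_, fun a l S => ?_⟩
    · simp only [den_par]
      constructor
      · rintro ⟨_, T, rfl, ⟨S₁, S₂, rfl, h₁, h₂⟩, h⟩
        exact ⟨S₁, _, add_assoc _ _ _, h₁, S₂, T, rfl, h₂, h⟩
      · rintro ⟨T, _, rfl, h, ⟨S₁, S₂, rfl, h₁, h₂⟩⟩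
        exact ⟨_, S₂, (add_assoc _ _ _).symm, ⟨T, S₁, rfl, h, h₁⟩, h₂⟩
    -- Exactly one of the three factors carries the restrictions and the other two have no threads,
    -- so associativity becomes propositional.
    · simp only [resDen_par, den_par_zero]
      tauto
  | unit => simp [den_par, den_nil, resDen_par, resDen_nil]
  | par N _ ih => simp [den_par, resDen_par, ih.1, ih.2]
  | @res M M' b _ ih =>
    refine ⟨fun S => by simp [den_res], fun a l S => ?_⟩
    rw [resDen_res, resDen_res]
    cases l with
    | nil => rw [resDen_flat, resDen_flat, ih.1]
    | cons c l => rw [ih.2]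

theorem NetCong.resDen_iff {t : Option (Agent n)} {M N : Net n} (h : NetCong (defs n) Γ t M N)
    (l : List Channel) (S : Multiset (Thread n)) : ResDen Γ l M S ↔ ResDen Γ l N S := by
  cases l with
  | nil => rw [resDen_flat, resDen_flat, h.den_iff.1]
  | cons a l => exact h.den_iff.2 a l S

end Invariance

/-! ### Networks with the same threads are structurally congruent -/

section Completeness

variable {n : ℕ} {Γ : Env n} {t : Option (Agent n)}

theorem NetCong.par_congr {D : List (ProcDef n)} {M M' N N' : Net n} (h : NetCong D Γ t M M')
    (h' : NetCong D Γ t N N') : NetCong D Γ t (.par M N) (.par M' N') :=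
  (h.par N).trans ((NetCong.comm _ _).trans ((h'.par M').trans (NetCong.comm _ _)))

theorem NetCong.prod_perm {D : List (ProcDef n)} {l l' : List (Net n)} (h : l.Perm l') :
    NetCong D Γ t (Net.prod l) (Net.prod l') := by
  induction h with
  | nil => exact .refl _
  | cons x _ ih => exact .par_congr (.refl _) ih
  | swap x y l =>
    exact (NetCong.assoc _ _ _).symm.trans (((NetCong.comm _ _).par _).trans (.assoc _ _ _))
  | trans _ _ ih ih' => exact ih.trans ih'

theorem NetCong.prod_append {D : List (ProcDef n)} (l l' : List (Net n)) :
    NetCong D Γ t (Net.prod (l ++ l')) (.par (Net.prod l) (Net.prod l')) := by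
  induction l with
  | nil => exact (NetCong.unit _).symm.trans (.comm _ _)
  | cons x l ih => exact (NetCong.par_congr (.refl x) ih).trans (NetCong.assoc _ _ _).symm

/-- The parallel composition of a multiset of threads. -/
noncomputable def threadNet (S : Multiset (Thread n)) : Net n :=
  .prod (S.toList.map fun x => .loc x.1 x.2)

theorem threadNet_add (D : List (ProcDef n)) (S T : Multiset (Thread n)) :
    NetCong D Γ t (threadNet (S + T)) (.par (threadNet S) (threadNet T)) := by
  refine NetCong.trans
    (NetCong.prod_perm (l' := (S.toList ++ T.toList).map fun x => .loc x.1 x.2) ?_) ?_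
  · refine List.Perm.map _ ?_
    rw [← Multiset.coe_eq_coe, ← Multiset.coe_add]
    simp only [Multiset.coe_toList]
  · rw [List.map_append]
    exact NetCong.prod_append _ _

theorem threadNet_singleton (D : List (ProcDef n)) (l : Loc n) (P : Proc n) :
    NetCong D Γ t (threadNet {(l, P)}) (.loc l P) := by
  simp only [threadNet, Multiset.toList_singleton]
  exact .unit _

/-- The rules of `Runs` only perform evaluations that `≡` allows. For a diverging call one unfolding
followed by the false test reaches the canonical thread. -/
theorem Runs.netCong (ht : t ≠ none) {l : Loc n} {P : Proc n} {S : Multiset (Thread n)}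
    (h : Runs Γ l P S) : NetCong (defs n) Γ t (.loc l P) (threadNet S) := by
  have zero : NetCong (defs n) Γ t .nil (threadNet 0) := by
    simp only [threadNet, Multiset.toList_zero]; exact .refl _
  induction h with
  | dead h => exact (NetCong.eval ht (.dead h)).trans zero
  | nil h => exact (NetCong.eval ht (.nil h)).trans zero
  | par h _ _ ih ih' =>
    exact (NetCong.eval ht (.split h)).trans ((NetCong.par_congr ih ih').trans
      (threadNet_add _ _ _).symm)
  | out h he => exact (NetCong.eval ht (.out h he)).trans (threadNet_singleton _ _ _).symm
  | waiting h _ => exact (threadNet_singleton _ _ _).symm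
  | ite_true h he hk _ ih => exact (NetCong.eval ht (.ite_true h he hk)).trans ih
  | ite_false h he _ ih => exact (NetCong.eval ht (.ite_false h he)).trans ih
  | call h he _ hσ _ ih => exact (NetCong.eval ht (.call h (defOf_mem _) he hσ)).trans ih
  | @diverges e i w b h he hb =>
    refine NetCong.trans ?_ (threadNet_singleton _ _ _).symm
    obtain ⟨σ, hσ, hbody⟩ := exists_wrap_matches n i w b
    refine (NetCong.eval ht (.call h (defOf_mem _) he hσ)).trans ?_
    rw [hbody]
    refine NetCong.eval ht (.ite_false h ?_)
    rw [Expr.nat, eval_eq]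
    simp [Value.ofProp, hb]

theorem Den.netCong (ht : t ≠ none) {M : Net n} {S : Multiset (Thread n)} (h : Den Γ M S) :
    NetCong (defs n) Γ t M (threadNet S) := by
  induction h with
  | nil => simp only [threadNet, Multiset.toList_zero]; exact .refl _
  | loc h => exact h.netCong ht
  | par _ _ ih ih' => exact (NetCong.par_congr ih ih').trans (threadNet_add _ _ _).symm

/-- Threads and restrictions determine the network up to `≡`: a factor outside the restrictions has
no threads, hence is congruent to 0 and can be dropped. -/
theorem ResDen.netCong (ht : t ≠ none) {l : List Channel} {M : Net n} {S : Multiset (Thread n)}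
    (h : ResDen Γ l M S) : NetCong (defs n) Γ t M (Net.resAll (threadNet S) l) := by
  have zero : ∀ {N : Net n}, Den Γ N 0 → NetCong (defs n) Γ t N .nil := by
    intro N h
    have := h.netCong ht
    rw [threadNet, Multiset.toList_zero] at this
    exact this
  induction h with
  | flat h => exact h.netCong ht
  | res _ ih => exact .res _ ih
  | par_left _ h ih =>
    exact (NetCong.par_congr ih (zero h)).trans (.unit _)
  | par_right h _ ih =>
    exact (NetCong.comm _ _).trans ((NetCong.par_congr ih (zero h)).trans (.unit _))

end Completeness

/-! ### Steps act on threads -/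

section Steps

variable {n : ℕ} {Γ Γ' : Env n}

open Classical in
/-- The threads at locations that are live in `Γ`. -/
noncomputable def survivors (Γ : Env n) (S : Multiset (Thread n)) : Multiset (Thread n) :=
  S.filter fun x => Live Γ x.1

theorem Runs.thread_loc {l : Loc n} {P : Proc n} {S : Multiset (Thread n)} (h : Runs Γ l P S) :
    ∀ x ∈ S, x.1 = l := by
  induction h with
  | par _ _ _ ih ih' =>
    intro x hx
    rcases Multiset.mem_add.1 hx with h | h
    exacts [ih x h, ih' x h]
  | ite_true _ _ _ _ ih => exact ih
  | ite_false _ _ _ ih => exact ih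
  | call _ _ _ _ _ ih => exact ih
  | _ => simp

theorem Live.anti (hΓ : Γ'.alive ⊆ Γ.alive) {l : Loc n} (h : Live Γ' l) : Live Γ l := by
  cases l with
  | wrap => trivial
  | agent p => exact hΓ h

/-- The environment enters evaluation only through the liveness of the one location concerned. -/
theorem Runs.of_live {l : Loc n} (hl : Live Γ l) (hl' : Live Γ' l) {P : Proc n}
    {S : Multiset (Thread n)} (h : Runs Γ l P S) : Runs Γ' l P S := by
  induction h with
  | dead h => exact absurd hl h
  | nil => exact .nil hl'
  | par _ _ _ ih ih' => exact .par hl' ih ih'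
  | out _ he => exact .out hl' he
  | waiting _ h => exact .waiting hl' h
  | ite_true _ he hk _ ih => exact .ite_true hl' he hk ih
  | ite_false _ he _ ih => exact .ite_false hl' he ih
  | call _ he hd hσ _ ih => exact .call hl' he hd hσ ih
  | diverges _ he hb => exact .diverges hl' he hb

/-- A location that has died evaluates to nothing and one still live evaluates as before, so crashes
act on threads as a filter. -/
theorem Den.survivors (hΓ : Γ'.alive ⊆ Γ.alive) {M : Net n} {S : Multiset (Thread n)}
    (h : Den Γ M S) : Den Γ' M (survivors Γ' S) := by
  classical
  induction h with
  | nil => simpa [ConsensusCalculus.survivors] using Den.nil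
  | @loc l P S h =>
    by_cases hl : Live Γ' l
    · have : ConsensusCalculus.survivors Γ' S = S :=
        Multiset.filter_eq_self.2 fun x hx => by rw [h.thread_loc x hx]; exact hl
      rw [this]
      exact .loc (h.of_live (hl.anti hΓ) hl)
    · have : ConsensusCalculus.survivors Γ' S = 0 :=
        Multiset.filter_eq_nil.2 fun x hx => by rw [h.thread_loc x hx]; exact hl
      rw [this]
      exact .loc (.dead hl)
  | par _ _ ih ih' =>
    rw [ConsensusCalculus.survivors, Multiset.filter_add]
    exact .par ih ih'

theorem survivors_zero : survivors Γ (0 : Multiset (Thread n)) = 0 := by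
  classical exact Multiset.filter_zero _

theorem survivors_add (S T : Multiset (Thread n)) :
    survivors Γ (S + T) = survivors Γ S + survivors Γ T := by
  classical exact Multiset.filter_add _ _ _

theorem ResDen.survivors (hΓ : Γ'.alive ⊆ Γ.alive) {l : List Channel} {M : Net n}
    {S : Multiset (Thread n)} (h : ResDen Γ l M S) :
    ResDen Γ' l M (survivors Γ' S) := by
  induction h with
  | flat h => exact .flat (h.survivors hΓ)
  | res _ ih => exact .res ih
  | par_left _ h ih => exact .par_left ih (by simpa only [survivors_zero] using h.survivors hΓ)
  | par_right h _ ih => exact .par_right (by simpa only [survivors_zero] using h.survivors hΓ) ih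

/-- A thread takes part in a transition and becomes a network. -/
inductive Fires {n : ℕ} : Thread n → Net n → Prop
  | snd {l c v} : Fires (l, .send c (.val v)) .nil
  | rcv {l c X P v σ} : X.matches v = some σ →
      Fires (l, .guarded (.inp c X P)) (.loc l (P.subst σ))
  | susp {l k P} : Fires (l, .guarded (.susp k P)) (.loc l P)
  | psusp {l k P} : Fires (l, .guarded (.psusp k P)) (.loc l P)
  | sum_left {l G G' Q} : Fires (l, .guarded G) Q → Fires (l, .guarded (.sum G G')) Q
  | sum_right {l G G' Q} : Fires (l, .guarded G') Q → Fires (l, .guarded (.sum G G')) Q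

/-- One thread, or two in the case of a communication, take part in a transition. The rest of the
threads is `S₀`. -/
inductive Active {n : ℕ} : Multiset (Thread n) → Act → Net n → Multiset (Thread n) → Prop
  | one {x Q α} (S₀) : Fires x Q → Active (x ::ₘ S₀) α Q S₀
  | two {x y Q Q'} (S₀) : Fires x Q → Fires y Q' →
      Active (x ::ₘ y ::ₘ S₀) .tau (.par Q Q') S₀

theorem Active.add {S S₀ : Multiset (Thread n)} {α : Act} {Q : Net n} (h : Active S α Q S₀)
    (T : Multiset (Thread n)) : Active (S + T) α Q (S₀ + T) := by
  cases h with
  | one _ h => rw [Multiset.cons_add]; exact .one _ h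
  | two _ h h' => rw [Multiset.cons_add, Multiset.cons_add]; exact .two _ h h'

theorem Active.fires_of_singleton {x : Thread n} {S₀ : Multiset (Thread n)} {α : Act} {Q : Net n}
    (h : Active {x} α Q S₀) : S₀ = 0 ∧ Fires x Q := by
  generalize hS : ({x} : Multiset (Thread n)) = S at h
  cases h with
  | one _ h =>
    obtain ⟨rfl, rfl⟩ := (Multiset.singleton_eq_cons_iff _).1 hS
    exact ⟨rfl, h⟩
  | two =>
    have := congrArg Multiset.card hS
    simp at this

/-- The effect of a transition on the threads of a network. -/
inductive Effect {n : ℕ} (α : Act) (l : List Channel) (S : Multiset (Thread n)) :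
    Config n → Config n → Prop
  | choose {Γ t M M'} : α = .tau → ResDen Γ l M' S → Effect α l S ⟨Γ, none, M⟩ ⟨Γ, some t, M'⟩
  | crash {Γ Γ' t M M'} : α = .tau → Γ'.alive ⊆ Γ.alive → Γ'.crashes < Γ.crashes →
      ResDen Γ' l M' (survivors Γ' S) → Effect α l S ⟨Γ, some t, M⟩ ⟨Γ', some t, M'⟩
  | act {Γ t M M' Q S₀} : Active S α Q S₀ → (∀ T, Den Γ Q T → ResDen Γ l M' (T + S₀)) →
      Effect α l S ⟨Γ, some t, M⟩ ⟨Γ, some t, M'⟩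

/-- Serves the rules for sums, with x a summand and y the sum. As the environment is unchanged and a
crash lowers its counter, the transition must be a firing of x. -/
theorem Effect.of_single {t : Agent n} {x y : Thread n} {k : Loc n} {P : Proc n} {α : Act}
    {l : List Channel} {M N : Net n}
    (h : Effect α l {x} ⟨Γ, some t, M⟩ ⟨Γ, some t, .loc k P⟩) (hxy : ∀ Q, Fires x Q → Fires y Q) :
    Effect α l {y} ⟨Γ, some t, N⟩ ⟨Γ, some t, .loc k P⟩ := by
  cases h with
  | crash _ _ h _ => exact absurd h (lt_irrefl _)
  | act ha h =>
    obtain ⟨rfl, hf⟩ := ha.fires_of_singleton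
    exact .act (.one 0 (hxy _ hf)) h

theorem runs_send {l : Loc n} (hl : Live Γ l) {c : ChanTerm} {v : Value}
    {S : Multiset (Thread n)} :
    Runs Γ l (.send c (.val v)) S ↔ S = {(l, .send c (.val v))} := by
  constructor
  · intro h
    cases h with
    | dead h => exact absurd hl h
    | out _ h => cases h; rfl
    | waiting _ h => cases h
  · rintro rfl
    exact .out hl rfl

/-- Guarded processes that start with an input, a suspicion or a choice have to wait. -/
def Guarded.Prefixed : Guarded n → Prop
  | .inp .. | .susp .. | .psusp .. | .sum .. => True
  | _ => False

theorem runs_waiting {l : Loc n} (hl : Live Γ l) {G : Guarded n} (hG : G.Prefixed)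
    {S : Multiset (Thread n)} :
    Runs Γ l (.guarded G) S ↔ Waiting G ∧ S = {(l, .guarded G)} := by
  constructor
  · intro h
    cases h with
    | dead h => exact absurd hl h
    | waiting _ h => exact ⟨h, rfl⟩
    | _ => exact absurd hG id
  · rintro ⟨h, rfl⟩
    exact .waiting hl h

theorem resDen_loc_flat {l : List Channel} {k : Loc n} {P : Proc n} {S : Multiset (Thread n)} :
    ResDen Γ l (.loc k P) S ↔ l = [] ∧ Runs Γ k P S := by
  cases l with
  | nil => simp [resDen_flat, den_loc]
  | cons a l => simp [resDen_loc]

/-- The restriction list and the multiset are quantified inside, since the rules for parallel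
composition and restriction apply the hypothesis to other ones. In the case `act` no evaluation of
the continuation is claimed to exist; the algorithm provides one later. -/
theorem Step.effect {C C' : Config n} {α : Act} (h : Step (defs n) C α C') :
    ∀ l S, ResDen C.env l C.net S → Effect α l S C C' := by
  induction h with
  | ti => exact fun l S h => .choose rfl h
  | crash =>
    exact fun l S h => .crash rfl (Finset.erase_subset _ _) (Nat.lt_succ_self _)
      (h.survivors (Finset.erase_subset _ _))
  | psusp hl =>
    intro l S h
    obtain ⟨rfl, h'⟩ := resDen_loc_flat.1 h
    obtain ⟨-, rfl⟩ := (runs_waiting hl (by exact trivial)).1 h'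
    exact .act (.one 0 .psusp) fun T hT => by simpa [resDen_flat] using hT
  | susp hl =>
    intro l S h
    obtain ⟨rfl, h'⟩ := resDen_loc_flat.1 h
    obtain ⟨-, rfl⟩ := (runs_waiting hl (by exact trivial)).1 h'
    exact .act (.one 0 .susp) fun T hT => by simpa [resDen_flat] using hT
  | tau hl =>
    intro l S h
    obtain ⟨rfl, h'⟩ := resDen_loc_flat.1 h
    -- Evaluation has no rule for a τ-prefix at a live location; the equations of the algorithm
    -- contain none.
    cases h' with
    | dead hd => exact absurd hl hd
  | sum_left hl _ ih =>
    intro l S h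
    obtain ⟨rfl, h'⟩ := resDen_loc_flat.1 h
    obtain ⟨hw, rfl⟩ := (runs_waiting hl (by exact trivial)).1 h'
    cases hw with
    | sum hw _ =>
      exact (ih [] _ (.flat (.loc (.waiting hl hw)))).of_single fun Q h => .sum_left h
  | sum_right hl _ ih =>
    intro l S h
    obtain ⟨rfl, h'⟩ := resDen_loc_flat.1 h
    obtain ⟨hw, rfl⟩ := (runs_waiting hl (by exact trivial)).1 h'
    cases hw with
    | sum _ hw =>
      exact (ih [] _ (.flat (.loc (.waiting hl hw)))).of_single fun Q h => .sum_right h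
  | @par Γ Γ' t M M' N α _ ih =>
    intro l S h
    cases l with
    | nil =>
      obtain ⟨S₁, S₂, rfl, h₁, h₂⟩ := den_par.1 (resDen_flat.1 h)
      cases ih [] S₁ (.flat h₁) with
      | crash hα hΓ hc h =>
        refine .crash hα hΓ hc (.flat ?_)
        rw [survivors_add]
        exact .par (resDen_flat.1 h) (h₂.survivors hΓ)
      | act ha h =>
        refine .act (ha.add S₂) fun T hT => .flat ?_
        rw [← add_assoc]
        exact .par (resDen_flat.1 (h T hT)) h₂
    | cons a l =>
      rcases resDen_par.1 h with ⟨h₁, h₂⟩ | ⟨h₁, h₂⟩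
      · cases ih (a :: l) S h₁ with
        | crash hα hΓ hc h =>
          exact .crash hα hΓ hc (.par_left h (by
            simpa only [survivors_zero] using h₂.survivors hΓ))
        | act ha h => exact .act ha fun T hT => .par_left (h T hT) h₂
      · cases ih [] 0 (.flat h₁) with
        | crash hα hΓ hc h =>
          refine .crash hα hΓ hc (.par_right ?_ (h₂.survivors hΓ))
          rw [survivors_zero] at h
          exact resDen_flat.1 h
        | act ha _ =>
          -- The left factor has no threads, so nothing in it can fire.
          generalize h0 : (0 : Multiset (Thread n)) = S at ha
          cases ha <;> exact absurd h0 (Multiset.zero_ne_cons)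
  | snd hl =>
    intro l S h
    obtain ⟨rfl, h'⟩ := resDen_loc_flat.1 h
    rw [runs_send hl] at h'
    subst h'
    exact .act (.one 0 .snd) fun T hT => by simpa [resDen_flat] using hT
  | rcv hl _ hσ =>
    intro l S h
    obtain ⟨rfl, h'⟩ := resDen_loc_flat.1 h
    obtain ⟨-, rfl⟩ := (runs_waiting hl (by exact trivial)).1 h'
    exact .act (.one 0 (.rcv hσ)) fun T hT => by simpa [resDen_flat] using hT
  | @com Γ t M M' N N' α hα _ _ ih ih' =>
    intro l S h
    have hα' : α.co ≠ .tau := by cases α <;> simp_all [Act.co]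
    -- A visible label rules out crashes and communications, so a single thread fires.
    have key : ∀ {β : Act} {l S} {M M' : Net n}, β ≠ .tau →
        Effect β l S ⟨Γ, some t, M⟩ ⟨Γ, some t, M'⟩ →
        ∃ x S₀ Q, S = x ::ₘ S₀ ∧ Fires x Q ∧ ∀ T, Den Γ Q T → ResDen Γ l M' (T + S₀) := by
      intro β l S M M' hβ h
      cases h with
      | crash h _ _ _ => exact absurd h hβ
      | act ha h =>
        cases ha with
        | one _ hf => exact ⟨_, _, _, rfl, hf, h⟩
        | two => exact absurd rfl hβ
    cases l with
    | nil =>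
      obtain ⟨S₁, S₂, rfl, h₁, h₂⟩ := den_par.1 (resDen_flat.1 h)
      obtain ⟨x, T₁, Q₁, rfl, hf₁, h₁⟩ := key hα (ih [] _ (.flat h₁))
      obtain ⟨y, T₂, Q₂, rfl, hf₂, h₂⟩ := key hα' (ih' [] _ (.flat h₂))
      have e : x ::ₘ T₁ + y ::ₘ T₂ = x ::ₘ y ::ₘ (T₁ + T₂) := by
        rw [Multiset.cons_add, Multiset.add_cons]
      rw [e]
      refine .act (.two _ hf₁ hf₂) fun T hT => .flat ?_
      obtain ⟨R₁, R₂, rfl, hR₁, hR₂⟩ := den_par.1 hT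
      rw [add_add_add_comm]
      exact .par (resDen_flat.1 (h₁ _ hR₁)) (resDen_flat.1 (h₂ _ hR₂))
    | cons a l =>
      -- Beside a factor that carries the restrictions the other one has no threads and cannot be a
      -- partner.
      exfalso
      rcases resDen_par.1 h with ⟨-, h₂⟩ | ⟨h₁, -⟩
      · obtain ⟨x, T₁, Q₁, h0, -⟩ := key hα' (ih' [] _ (.flat h₂))
        exact Multiset.zero_ne_cons h0
      · obtain ⟨x, T₁, Q₁, h0, -⟩ := key hα (ih [] _ (.flat h₁))
        exact Multiset.zero_ne_cons h0
  | @red C C₁ C₂ C' α hC _ hC' ih =>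
    intro l S h
    obtain ⟨Γ, t, M⟩ := C
    obtain ⟨Γ₁, t₁, M₁⟩ := C₁
    obtain ⟨Γ₂, t₂, M₂⟩ := C₂
    obtain ⟨Γ', t', M'⟩ := C'
    obtain ⟨e₁, e₂, hC⟩ := hC
    obtain ⟨e₃, e₄, hC'⟩ := hC'
    dsimp only at e₁ e₂ e₃ e₄ h hC hC' ih
    subst e₁ e₂ e₃ e₄
    cases ih l S ((hC.resDen_iff l S).1 h) with
    | choose hα h => exact .choose hα ((hC'.resDen_iff l S).1 h)
    | crash hα hΓ hc h => exact .crash hα hΓ hc ((hC'.resDen_iff l _).1 h)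
    | act ha h => exact .act ha fun T hT => (hC'.resDen_iff l _).1 (h T hT)
  | res _ _ _ ih =>
    intro l S h
    cases l with
    | nil => exact absurd (resDen_flat.1 h) den_res
    | cons b l =>
      obtain ⟨rfl, h⟩ := resDen_res.1 h
      cases ih l S h with
      | crash hα hΓ hc h => exact .crash hα hΓ hc (.res h)
      | act ha h => exact .act ha fun T hT => .res (h T hT)

end Steps


/-! ### The threads of the algorithm -/

section Threads

variable {n : ℕ}

/-- A pending message of the first phase. -/
def msgA (p i : Agent n) (r : ℕ) (W : Value) : Thread n :=
  (.agent p, .send (chanA (.nat p.number) (.nat i.number) (.nat r)) (.val W))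

/-- A pending message of the second phase. -/
def msgB (p i : Agent n) (V : Value) : Thread n :=
  (.agent p, .send (chanB (.nat p.number) (.nat i.number)) (.val V))

/-- A pending decision. -/
def msgC (p : Agent n) (V : Value) : Thread n :=
  (.agent p, .send (chanC (.nat p.number)) (.val V))

/-- Agent `p` waits for the message of agent `k` in round `r` of the first phase. -/
def waitA (p : Agent n) (r : ℕ) (V M : Value) (k : ℕ) : Thread n :=
  (.agent p, .guarded (.inpOrSusp (chanA (.nat k) (.nat p.number) (.nat r)) xW (.index (.nat k))
    (.call (.C1 p) (.tuple₄ (.nat r) (.val V)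
      (.app₂ .insert (.val M) (.tuple₃ (.var xW) (.nat r) (.nat k))) (.app .succ (.nat k))))))

/-- Agent `p` waits for the message of agent `k` in the second phase. -/
def waitB (p : Agent n) (V M : Value) (k : ℕ) : Thread n :=
  (.agent p, .guarded (.inpOrSusp (chanB (.nat k) (.nat p.number)) xV' (.index (.nat k))
    (.call (.C2 p) (.tuple₃ (.val V)
      (.app₂ .insert (.val M) (.pair (.var xV') (.nat k))) (.app .succ (.nat k))))))

/-- The process after the wrapper has received a decision. -/
def wrapTest (n j : ℕ) (w : Value) : Proc n :=
  .ite
    (.app₂ .or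
      (.app₂ .and (.app₂ .eq (.val w) (.val .bot)) (.app .not (.app₂ .eq (.var xv') (.val .bot))))
      (.app₂ .eq (.val w) (.var xv')))
    (.call .WRAP (.tuple₃ (.app .succ (.nat j)) (.var xv') (.nat 1)))
    (.call .WRAP (.tuple₃ (.nat j) (.val w) (.nat 0)))

/-- The wrapper waits for the decision of agent `j`. -/
def waitC (n j : ℕ) (w : Value) : Thread n :=
  (.wrap, .guarded (.sum
    (.psusp (.index (.nat j)) (.call .WRAP (.tuple₃ (.app .succ (.nat j)) (.val w) (.nat 1))))
    (.inp (chanC (.nat j)) (.var xv') (wrapTest n j w))))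

/-- The threads of the wrapper. -/
def wrapThreads (n j : ℕ) (w : Value) (b : ℕ) : Multiset (Thread n) :=
  if b = 1 then
    if 1 ≤ j ∧ j ≤ n then {waitC n j w}
    else if j = n + 1 then {(.wrap, .send chanOk (.val .bot))} else 0
  else {(.wrap, .call .WRAP (.tuple₃ (.nat j) (.val w) (.nat 0)))}

/-- The messages of agent `p` in round `r` of the first phase. -/
def castA (p : Agent n) (r : ℕ) (W : Value) : Multiset (Thread n) :=
  (Finset.univ : Finset (Agent n)).val.map fun i => msgA p i r W

/-- The messages of agent `p` in the second phase. -/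
def castB (p : Agent n) (V : Value) : Multiset (Thread n) :=
  (Finset.univ : Finset (Agent n)).val.map fun i => msgB p i V

end Threads

/-! ### Evaluation of calls -/

section Calls

variable {n : ℕ} {Γ : Env n} {l : Loc n}

@[simp] theorem Value.fst_pair (a b : Value) : (Value.pair a b).fst = a := by simp [Value.fst]

@[simp] theorem Value.snd_pair (a b : Value) : (Value.pair a b).snd = b := by simp [Value.snd]

@[simp] theorem Value.toNat_num (k : ℕ) : (Value.num k).toNat = k := rfl

theorem Value.num_injective : Function.Injective Value.num := fun _ _ => Value.num_inj

theorem Value.ofProp_true {p : Prop} (h : p) : Value.ofProp p = .num 1 := if_pos h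

theorem Value.ofProp_false {p : Prop} (h : ¬ p) : Value.ofProp p = .num 0 := if_neg h

theorem Value.toNat_ofProp (p : Prop) : 0 < (Value.ofProp p).toNat ↔ p := by
  by_cases h : p
  · rw [Value.ofProp_true h]; simp [h]
  · rw [Value.ofProp_false h]; simp [h]

theorem Value.toNat_ofProp_eq_zero (p : Prop) : (Value.ofProp p).toNat = 0 ↔ ¬ p := by
  rw [← not_iff_not, not_not, ← ne_eq, ← Nat.pos_iff_ne_zero, Value.toNat_ofProp]

theorem Runs.ite_ofProp {e : Expr} {p : Prop} {P Q : Proc n} {S : Multiset (Thread n)}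
    (hl : Live Γ l) (he : Expr.eval n e = some (.ofProp p)) (hP : p → Runs Γ l P S)
    (hQ : ¬ p → Runs Γ l Q S) : Runs Γ l (.ite e P Q) S := by
  by_cases h : p
  · rw [Value.ofProp_true h] at he
    exact .ite_true hl he one_pos (hP h)
  · rw [Value.ofProp_false h] at he
    exact .ite_false hl he (hQ h)

theorem runs_prod {α : Type*} (hl : Live Γ l) (f : α → Proc n) (g : α → Thread n) (L : List α)
    (h : ∀ x ∈ L, Runs Γ l (f x) {g x}) :
    Runs Γ l (.prod (L.map f)) (L.map g : Multiset (Thread n)) := by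
  induction L with
  | nil => exact .nil hl
  | cons x L ih =>
    exact .par hl (h x (by simp)) (ih fun y hy => h y (by simp [hy]))

theorem subst_prod (σ : Subst) (L : List (Proc n)) :
    (Proc.prod L).subst σ = .prod (L.map (Proc.subst σ)) := by
  induction L with
  | nil => simp [Proc.prod, Proc.nil, Proc.subst, Guarded.subst]
  | cons x L ih =>
    simp only [Proc.prod, List.foldr_cons, List.map_cons, Proc.subst] at ih ⊢
    rw [ih]

theorem Runs.call_of {K : Const n} {e : Expr} {v : Value} {P : Proc n} {S : Multiset (Thread n)}
    (hl : Live Γ l) (he : Expr.eval n e = some v)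
    (hP : ∃ σ, (defOf K).params.matches v = some σ ∧ (defOf K).body.subst σ = P)
    (h : Runs Γ l P S) : Runs Γ l (.call K e) S := by
  obtain ⟨σ, hσ, rfl⟩ := hP
  exact (runs_call_iff hl (defOf_mem K) he hσ).2 h

theorem waiting_inpOrSusp (c : ChanTerm) (x : Var) (k : LocTerm n) (P : Proc n) :
    Waiting (.inpOrSusp c x k P) := .sum (.inp ..) (.susp ..)

variable {p : Agent n} {e : Expr}

theorem runs_P3 (hp : Live Γ (.agent p)) {V : Value} (he : Expr.eval n e = some V) :
    Runs Γ (.agent p) (.call (.P3 p) e) {msgC p (getFst n V)} := by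
  refine .call_of (P := .send (chanC (.nat p.number)) (.app .getFst (.val V))) hp he
    ⟨_, rfl, ?_⟩ (.out hp rfl)
  simp [defOf, defP3, Proc.send, Proc.nil, Proc.subst, Guarded.subst, Expr.subst, Expr.nat, chanC,
    ChanTerm.subst]

/-- After the last agent, evaluation runs through P3 up to the pending decision; this is why P3 does
not occur in normal forms. -/
theorem runs_C2 (hp : Live Γ (.agent p)) {V M : Value} {k : ℕ}
    (he : Expr.eval n e = some (.pair V (.pair M (.num k)))) :
    Runs Γ (.agent p) (.call (.C2 p) e)
      (if k ≤ n then {waitB p V M k} else {msgC p (getFst n (correctK n M V))}) := by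
  refine .call_of (P := .ite (.app₂ .le (.nat k) (.nat n)) (waitB p V M k).2
    (.call (.P3 p) (.app₂ .correctK (.val M) (.val V)))) hp he
    ⟨_, by simp only [defOf, defC2, Pattern.matches, Value.asPair_pair, Option.bind_some,
      Option.map_some]; rfl, ?_⟩ ?_
  · simp [defOf, defC2, waitB, Guarded.inpOrSusp, Proc.ite, Proc.subst, Guarded.subst,
      Expr.subst, Expr.app₂, Expr.tuple₃, Expr.nat, chanB, ChanTerm.subst, LocTerm.subst,
      Subst.erase, Pattern.vars]
  · refine .ite_ofProp (p := k ≤ n) hp (by simp [Expr.eval, Expr.app₂, Expr.nat, Fn.apply])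
      (fun h => ?_) fun h => ?_
    · rw [if_pos h]
      exact .waiting hp (waiting_inpOrSusp ..)
    · rw [if_neg h]
      exact runs_P3 hp (by simp [Expr.eval, Expr.app₂, Fn.apply])

theorem runs_P2 (hn : 1 ≤ n) (hp : Live Γ (.agent p)) {V M : Value}
    (he : Expr.eval n e = some (.pair V M)) :
    Runs Γ (.agent p) (.call (.P2 p) e) (castB p V + {waitB p V M 1}) := by
  refine .call_of (P := .par
    (.prod ((List.finRange n).map fun i : Agent n => (msgB p i V).2))
    (.call (.C2 p) (.tuple₃ (.val V) (.val M) (.nat 1)))) hp he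
    ⟨_, by simp only [defOf, defP2, Pattern.matches, Value.asPair_pair, Option.bind_some,
      Option.map_some]; rfl, ?_⟩ (.par hp ?_ ?_)
  · simp [defOf, defP2, msgB, Proc.subst, subst_prod, Function.comp_def, Proc.send, Proc.nil,
      Guarded.subst, Expr.subst, Expr.tuple₃, Expr.nat, chanB, ChanTerm.subst]
  · exact runs_prod hp _ (fun i => msgB p i V) _ fun i _ => .out hp rfl
  · have := runs_C2 (e := .tuple₃ (.val V) (.val M) (.nat 1)) hp rfl
    rwa [if_pos hn] at this

/-- The threads of agent `p` at the beginning of round `r`. -/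
noncomputable def roundThreads (p : Agent n) (r : ℕ) (V W M : Value) : Multiset (Thread n) :=
  if r < n then castA p r W + {waitA p r V M 1} else castB p V + {waitB p V M 1}

/-- The equation of `C1` with its parameters instantiated. -/
theorem exists_C1_matches (p : Agent n) (r : ℕ) (V M : Value) (k : ℕ) :
    ∃ σ, (defOf (.C1 p)).params.matches (.pair (.num r) (.pair V (.pair M (.num k)))) = some σ ∧
      (defOf (.C1 p)).body.subst σ = .ite (.app₂ .le (.nat k) (.nat n)) (waitA p r V M k).2
        (.call (.P1 p) (.tuple₄ (.app .succ (.nat r))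
          (.app .updateK (.tuple₃ (.nat r) (.val M) (.val V)))
          (.app .updateR (.tuple₃ (.nat r) (.val M) (.val V))) (.val M))) := by
  refine ⟨_, by simp only [defOf, defC1, Pattern.matches, Value.asPair_pair, Option.bind_some,
      Option.map_some]; rfl, ?_⟩
  simp [defOf, defC1, waitA, Guarded.inpOrSusp, Proc.ite, Proc.subst, Guarded.subst,
    Expr.subst, Expr.app₂, Expr.tuple₃, Expr.tuple₄, Expr.nat, chanA, ChanTerm.subst,
    LocTerm.subst, Subst.erase, Pattern.vars]

theorem eval_le (j k : ℕ) :
    Expr.eval n (.app₂ .le (.nat j) (.nat k)) = some (.ofProp (j ≤ k)) := by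
  simp [Expr.eval, Expr.app₂, Expr.nat, Fn.apply]

theorem runs_C1_wait (hp : Live Γ (.agent p)) {V M : Value} {r k : ℕ} (hk : k ≤ n)
    (he : Expr.eval n e = some (.pair (.num r) (.pair V (.pair M (.num k))))) :
    Runs Γ (.agent p) (.call (.C1 p) e) {waitA p r V M k} :=
  .call_of hp he (exists_C1_matches p r V M k) (.ite_ofProp hp (eval_le k n)
    (fun _ => .waiting hp (waiting_inpOrSusp ..)) fun h => absurd hk h)

theorem runs_P1 (hn : 1 ≤ n) (hp : Live Γ (.agent p)) {V W M : Value} {r : ℕ}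
    (he : Expr.eval n e = some (.pair (.num r) (.pair V (.pair W M)))) :
    Runs Γ (.agent p) (.call (.P1 p) e) (roundThreads p r V W M) := by
  refine .call_of (P := .ite (.app₂ .lt (.nat r) (.nat n))
    (.par (.prod ((List.finRange n).map fun i : Agent n => (msgA p i r W).2))
      (.call (.C1 p) (.tuple₄ (.nat r) (.val V) (.val M) (.nat 1))))
    (.call (.P2 p) (.pair (.val V) (.val M)))) hp he
    ⟨_, by simp only [defOf, defP1, Pattern.matches, Value.asPair_pair, Option.bind_some,
      Option.map_some]; rfl, ?_⟩ ?_
  · simp [defOf, defP1, msgA, Proc.ite, Proc.subst, subst_prod, Function.comp_def, Proc.send,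
      Proc.nil, Guarded.subst, Expr.subst, Expr.app₂, Expr.tuple₄, Expr.nat, chanA,
      ChanTerm.subst]
  · refine .ite_ofProp (p := r < n) hp (by simp [Expr.eval, Expr.app₂, Expr.nat, Fn.apply])
      (fun h => ?_) fun h => ?_
    · rw [roundThreads, if_pos h]
      exact .par hp (runs_prod hp _ (fun i => msgA p i r W) _ fun i _ => .out hp rfl)
        (runs_C1_wait hp hn rfl)
    · rw [roundThreads, if_neg h]
      exact runs_P2 hn hp rfl

/-- After the last agent of a round, evaluation runs through P1, and through P2 if there is no
further round, until the next collector waits. Hence P1 and P2 do not occur in normal forms. -/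
theorem runs_C1_next (hn : 1 ≤ n) (hp : Live Γ (.agent p)) {V M : Value} {r k : ℕ} (hk : n < k)
    (he : Expr.eval n e = some (.pair (.num r) (.pair V (.pair M (.num k))))) :
    Runs Γ (.agent p) (.call (.C1 p) e)
      (roundThreads p (r + 1) (updateK n (.num r) M V) (updateR n (.num r) M V) M) :=
  .call_of hp he (exists_C1_matches p r V M k) (.ite_ofProp hp (eval_le k n)
    (fun h => absurd h hk.not_ge) fun _ => runs_P1 hn hp (by
      simp [Expr.eval, Expr.tuple₄, Expr.tuple₃, Expr.nat, Fn.apply]))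

theorem runs_WRAP {w : Value} {j b : ℕ}
    (he : Expr.eval n e = some (.pair (.num j) (.pair w (.num b)))) :
    Runs Γ .wrap (.call .WRAP e) (wrapThreads n j w b) := by
  have hl : Live Γ .wrap := trivial
  by_cases hb : b = 1
  · subst hb
    refine .call_of hl he (exists_wrap_matches n _ _ _) (.ite_true (k := 1) hl ?_ one_pos ?_)
    · rw [Expr.nat, eval_eq, Value.ofProp_true rfl]
    · refine .ite_ofProp (p := 1 ≤ j ∧ j ≤ n) hl ?_ (fun h => ?_) fun h => ?_
      · simp [Expr.eval, Expr.app₂, Expr.nat, Fn.apply, Value.toNat_ofProp]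
      · rw [wrapThreads, if_pos rfl, if_pos h]
        exact .waiting hl (.sum (.psusp ..) (.inp ..))
      · rw [wrapThreads, if_pos rfl, if_neg h]
        refine .ite_ofProp (p := j = n + 1) hl ?_ (fun h => ?_) fun h => ?_
        · rw [Expr.nat, eval_eq, Value.num_injective.eq_iff]
        · rw [if_pos h]
          exact .out hl rfl
        · rw [if_neg h]
          exact .nil hl
  · rw [wrapThreads, if_neg hb]
    exact .diverges hl he fun h => hb (Value.num_inj h)

end Calls

/-! ### Transitions of the threads -/

section Fires

variable {n : ℕ}

theorem fires_send {l : Loc n} {c : ChanTerm} {e : Expr} {Q : Net n}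
    (h : Fires (l, .send c e) Q) : Q = .nil := by
  cases h
  rfl

/-- A suspicion leaves the same continuation as the receipt of ⊥, so both cases have one shape. -/
theorem fires_inpOrSusp {l : Loc n} {c : ChanTerm} {x : Var} {k : LocTerm n} {P : Proc n}
    {Q : Net n} (h : Fires (l, .guarded (.inpOrSusp c x k P)) Q) :
    ∃ v : Value, Q = .loc l (P.subst fun y => if y = x then some v else none) := by
  cases h with
  | sum_left h =>
    cases h with
    | rcv h => cases h; exact ⟨_, rfl⟩
  | sum_right h => cases h; exact ⟨_, rfl⟩

/-- What was received affects only the collected set, which may stay unspecified. -/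
theorem fires_waitA {p : Agent n} {r k : ℕ} {V M : Value} {Q : Net n}
    (h : Fires (waitA p r V M k) Q) : ∃ e M', Q = .loc (.agent p) (.call (.C1 p) e) ∧
      Expr.eval n e = some (.pair (.num r) (.pair V (.pair M' (.num (k + 1))))) := by
  obtain ⟨v, rfl⟩ := fires_inpOrSusp h
  refine ⟨_, .insert (.pair v (.pair (.num r) (.num k))) M, by rw [Proc.subst], ?_⟩
  simp [Expr.tuple₄, Expr.tuple₃, Expr.app₂, Expr.subst, Expr.nat, Expr.eval, Fn.apply]

theorem fires_waitB {p : Agent n} {k : ℕ} {V M : Value} {Q : Net n}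
    (h : Fires (waitB p V M k) Q) : ∃ e M', Q = .loc (.agent p) (.call (.C2 p) e) ∧
      Expr.eval n e = some (.pair V (.pair M' (.num (k + 1)))) := by
  obtain ⟨v, rfl⟩ := fires_inpOrSusp h
  refine ⟨_, .insert (.pair v (.num k)) M, by rw [Proc.subst], ?_⟩
  simp [Expr.tuple₃, Expr.app₂, Expr.subst, Expr.nat, Expr.eval, Fn.apply]

/-- A detected crash or an accepted decision advances the index; a rejected decision keeps it and
clears the flag. -/
theorem fires_waitC {Γ : Env n} {j : ℕ} {w : Value} {Q : Net n} (h : Fires (waitC n j w) Q) :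
    ∃ j' w' b', Den Γ Q (wrapThreads n j' w' b') ∧ (j' = j + 1 ∧ b' = 1 ∨ j' = j ∧ b' = 0) := by
  have hl : Live Γ .wrap := trivial
  cases h with
  | sum_left h =>
    cases h
    exact ⟨j + 1, w, 1, .loc (runs_WRAP (by simp [Expr.tuple₃, Expr.nat, Expr.eval, Fn.apply])),
      .inl ⟨rfl, rfl⟩⟩
  | sum_right h =>
    cases h with
    | @rcv _ _ _ _ v _ h =>
      cases h
      by_cases hc : (w = .bot ∧ v ≠ .bot) ∨ w = v
      · refine ⟨j + 1, v, 1, .loc (.ite_true (k := 1) hl ?_ one_pos (runs_WRAP ?_)),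
          .inl ⟨rfl, rfl⟩⟩
        · simpa [Expr.subst, Expr.app₂, Expr.eval, Fn.apply, Value.toNat_ofProp,
            Value.toNat_ofProp_eq_zero] using Value.ofProp_true hc
        · simp [Expr.subst, Expr.tuple₃, Expr.nat, Expr.eval, Fn.apply]
      · refine ⟨j, w, 0, .loc (.ite_false hl ?_ (runs_WRAP ?_)), .inr ⟨rfl, rfl⟩⟩
        · simpa [Expr.subst, Expr.app₂, Expr.eval, Fn.apply, Value.toNat_ofProp,
            Value.toNat_ofProp_eq_zero] using Value.ofProp_false hc
        · simp [Expr.subst, Expr.tuple₃, Expr.nat, Expr.eval]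

end Fires


/-! ### Threads of normal forms -/

namespace NFData

variable {n : ℕ}

/-- The threads of the agents in a normal form. -/
def agentThreads (F : NFData n) : Multiset (Thread n) :=
  (F.out1.val.map fun x => msgA x.1 x.2.1 x.2.2 (F.W x.1 x.2.2)) +
    (F.out2.val.map fun x => msgB x.1 x.2 (F.V2 x.1)) +
    (F.out3.val.map fun p => msgC p (F.V3 p)) +
    (F.col1.val.map fun x => waitA x.1 x.2 (F.V1 x.1) (F.M1 x.1) (F.I1 x.1)) +
    F.col2.val.map fun p => waitB p (F.V2 p) (F.M2 p) (F.I2 p)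

/-- The threads of a normal form. -/
def threads (F : NFData n) : Multiset (Thread n) :=
  F.agentThreads + wrapThreads n F.wj F.ww F.wb

theorem den_prod {Γ : Env n} {α : Type*} (s : Finset α) (f : α → Net n) (g : α → Thread n)
    (h : ∀ x ∈ s, Den Γ (f x) {g x}) : Den Γ (.prod (s.toList.map f)) (s.val.map g) := by
  rw [← Finset.coe_toList s, Multiset.map_coe]
  have h : ∀ x ∈ s.toList, Den Γ (f x) {g x} := fun x hx => h x (Finset.mem_toList.1 hx)
  generalize s.toList = L at h
  induction L with
  | nil => exact .nil
  | cons x L ih => exact .par (h x (by simp)) (ih fun y hy => h y (by simp [hy]))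

theorem _root_.ConsensusCalculus.ResDen.resAll {Γ : Env n} {M : Net n} {S : Multiset (Thread n)}
    (h : Den Γ M S) (l : List Channel) : ResDen Γ l (Net.resAll M l) S := by
  induction l with
  | nil => exact .flat h
  | cons a l ih => exact .res ih

/-- The bounds on I¹ and I² make the collectors wait instead of running on, and liveness keeps the
threads from vanishing. -/
theorem Valid.resDen_net {F : NFData n} {Γ : Env n} (hF : F.Valid Γ) :
    ResDen Γ (restricted n) F.net F.threads := by
  refine .resAll ?_ _
  simp only [threads, agentThreads, add_assoc]
  refine .par (den_prod _ _ _ fun x hx => .loc (.out (hF.out1 x hx).1 rfl)) ?_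
  refine .par (den_prod _ _ _ fun x hx => .loc (.out (hF.out2 x hx) rfl)) ?_
  refine .par (den_prod _ _ _ fun x hx => .loc (.out (hF.out3 x hx) rfl)) ?_
  refine .par (den_prod _ _ _ fun x hx => .loc ?_) ?_
  · exact runs_C1_wait (hF.col1 x hx).1 (hF.col1 x hx).2.2 rfl
  refine .par (den_prod _ _ _ fun p hp => .loc ?_) (.loc (runs_WRAP rfl))
  have := runs_C2 (e := .tuple₃ (.val (F.V2 p)) (.val (F.M2 p)) (.nat (F.I2 p)))
    (hF.col2 p hp).1 rfl
  rwa [if_pos (hF.col2 p hp).2] at this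

-- The invariant on parameters, and giving threads to an idle agent.

/-- Every agent is in at most one phase, and has not yet sent messages of later rounds. -/
structure Consistent (F : NFData n) : Prop where
  round : ∀ x ∈ F.col1, ∀ y ∈ F.col1, x.1 = y.1 → x.2 = y.2
  out1 : ∀ x ∈ F.col1, ∀ y ∈ F.out1, y.1 = x.1 → y.2.2 ≤ x.2
  out2 : ∀ x ∈ F.col1, ∀ y ∈ F.out2, y.1 ≠ x.1
  out3 : ∀ x ∈ F.col1, x.1 ∉ F.out3
  col2 : ∀ x ∈ F.col1, x.1 ∉ F.col2
  out3' : ∀ p ∈ F.col2, p ∉ F.out3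

/-- Agent `p` does not run and has only messages of the first phase pending, up to round `r`. -/
structure Idle (F : NFData n) (p : Agent n) (r : ℕ) : Prop where
  col1 : ∀ x ∈ F.col1, x.1 ≠ p
  col2 : p ∉ F.col2
  out1 : ∀ x ∈ F.out1, x.1 = p → x.2.2 ≤ r
  out2 : ∀ x ∈ F.out2, x.1 ≠ p
  out3 : p ∉ F.out3

/-- Some of the threads of `F` are taken away. -/
structure Sub (G F : NFData n) : Prop where
  out1 : G.out1 ⊆ F.out1
  out2 : G.out2 ⊆ F.out2
  out3 : G.out3 ⊆ F.out3
  col1 : G.col1 ⊆ F.col1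
  col2 : G.col2 ⊆ F.col2

theorem Consistent.sub {F G : NFData n} (hF : F.Consistent) (h : G.Sub F) : G.Consistent where
  round x hx y hy := hF.round x (h.col1 hx) y (h.col1 hy)
  out1 x hx y hy := hF.out1 x (h.col1 hx) y (h.out1 hy)
  out2 x hx y hy := hF.out2 x (h.col1 hx) y (h.out2 hy)
  out3 x hx hy := hF.out3 x (h.col1 hx) (h.out3 hy)
  col2 x hx hy := hF.col2 x (h.col1 hx) (h.col2 hy)
  out3' p hp hy := hF.out3' p (h.col2 hp) (h.out3 hy)

/-- The parameters are admissible. -/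
def Good (F : NFData n) (Γ : Env n) : Prop := F.Valid Γ ∧ F.Consistent

theorem Good.sub {F G : NFData n} {Γ : Env n} (hF : F.Good Γ) (h : G.Sub F) (hI1 : G.I1 = F.I1)
    (hI2 : G.I2 = F.I2) (hj : G.wj = F.wj) (hb : G.wb = F.wb) : G.Good Γ := by
  refine ⟨?_, hF.2.sub h⟩
  exact {
    out1 := fun x hx => hF.1.out1 x (h.out1 hx)
    out2 := fun x hx => hF.1.out2 x (h.out2 hx)
    out3 := fun x hx => hF.1.out3 x (h.out3 hx)
    col1 := fun x hx => by rw [hI1]; exact hF.1.col1 x (h.col1 hx)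
    col2 := fun x hx => by rw [hI2]; exact hF.1.col2 x (h.col2 hx)
    wrap := by rw [hj, hb]; exact hF.1.wrap }

/-- `F` is obtained from `G` by giving the threads in `T` to agent `p`. -/
structure Adds (G F : NFData n) (p : Agent n) (T : Multiset (Thread n)) : Prop where
  threads : F.threads = T + G.threads
  idle : ∀ q r, q ≠ p → G.Idle q r → F.Idle q r

variable {Γ : Env n} {G : NFData n} {p : Agent n} {r : ℕ}

/-- No collector of the first phase belongs to p, so V¹_p, M¹_p and I¹_p are free to be overwritten.
-/
theorem Good.add_waitA (hG : G.Good Γ) (hi : G.Idle p r) (hp : Live Γ (.agent p)) (hr : r < n)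
    (V M : Value) {k : ℕ} (hk : k ≤ n) :
    ∃ F : NFData n, F.Good Γ ∧ G.Adds F p {waitA p r V M k} := by
  have hnew : (p, r) ∉ G.col1 := fun h => hi.col1 _ h rfl
  refine ⟨{ G with
    col1 := .cons (p, r) G.col1 hnew
    V1 := Function.update G.V1 p V
    M1 := Function.update G.M1 p M
    I1 := Function.update G.I1 p k }, ⟨?_, ?_⟩, ?_, ?_⟩
  · refine { hG.1 with col1 := ?_ }
    intro x hx
    rcases (Finset.mem_cons (h := hnew)).1 hx with rfl | hx
    · simpa using ⟨hp, hr, hk⟩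
    · simpa [Function.update_of_ne (hi.col1 x hx)] using hG.1.col1 x hx
  · constructor
    · intro x hx y hy hxy
      rcases (Finset.mem_cons (h := hnew)).1 hx with rfl | hx <;> rcases (Finset.mem_cons (h := hnew)).1 hy with rfl | hy
      · rfl
      · exact absurd hxy.symm (hi.col1 y hy)
      · exact absurd hxy (hi.col1 x hx)
      · exact hG.2.round x hx y hy hxy
    · intro x hx
      rcases (Finset.mem_cons (h := hnew)).1 hx with rfl | hx
      exacts [hi.out1, hG.2.out1 x hx]
    · intro x hx
      rcases (Finset.mem_cons (h := hnew)).1 hx with rfl | hx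
      exacts [hi.out2, hG.2.out2 x hx]
    · intro x hx
      rcases (Finset.mem_cons (h := hnew)).1 hx with rfl | hx
      exacts [hi.out3, hG.2.out3 x hx]
    · intro x hx
      rcases (Finset.mem_cons (h := hnew)).1 hx with rfl | hx
      exacts [hi.col2, hG.2.col2 x hx]
    · exact hG.2.out3'
  · have : G.col1.val.map (fun x => waitA x.1 x.2 (Function.update G.V1 p V x.1)
        (Function.update G.M1 p M x.1) (Function.update G.I1 p k x.1)) =
        G.col1.val.map fun x => waitA x.1 x.2 (G.V1 x.1) (G.M1 x.1) (G.I1 x.1) :=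
      Multiset.map_congr rfl fun x hx => by simp [Function.update_of_ne (hi.col1 x hx)]
    simp only [NFData.threads, agentThreads, Finset.cons_val, Multiset.map_cons, this,
      Function.update_self, Multiset.singleton_add, Multiset.add_cons, Multiset.cons_add]
  · intro q s hq h
    refine { h with col1 := fun x hx => ?_ }
    rcases (Finset.mem_cons (h := hnew)).1 hx with rfl | hx
    exacts [hq.symm, h.col1 x hx]

/-- Pending messages of p have rounds at most r. The new triples are therefore new, and W_{p,r+1} is
not yet in use. -/
theorem Good.add_castA (hG : G.Good Γ) (hi : G.Idle p r) (hp : Live Γ (.agent p))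
    (hr : r + 1 < n) (W : Value) :
    ∃ F : NFData n, F.Good Γ ∧ F.Idle p (r + 1) ∧ G.Adds F p (castA p (r + 1) W) := by
  obtain ⟨f, hf⟩ : ∃ f : Agent n ↪ Agent n × Agent n × ℕ, ∀ i, f i = (p, i, r + 1) :=
    ⟨⟨fun i => (p, i, r + 1), fun i j h => by simpa using h⟩, fun _ => rfl⟩
  have hd : Disjoint (Finset.univ.map f) G.out1 := by
    rw [Finset.disjoint_left]
    intro x hx hx'
    obtain ⟨i, -, rfl⟩ := Finset.mem_map.1 hx
    have := hi.out1 _ hx' (by rw [hf])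
    simp [hf] at this
  have hmem : ∀ x ∈ (Finset.univ.map f).disjUnion G.out1 hd,
      (x.1 = p ∧ x.2.2 = r + 1) ∨ x ∈ G.out1 := by
    intro x hx
    rcases Finset.mem_disjUnion.1 hx with hx | hx
    · obtain ⟨i, -, rfl⟩ := Finset.mem_map.1 hx
      simp [hf]
    · exact .inr hx
  refine ⟨{ G with
    out1 := (Finset.univ.map f).disjUnion G.out1 hd
    W := fun q s => if q = p ∧ s = r + 1 then W else G.W q s }, ⟨?_, ?_⟩, ?_, ?_, ?_⟩
  · refine { hG.1 with out1 := ?_ }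
    intro x hx
    rcases hmem x hx with ⟨h, h'⟩ | hx
    exacts [by rw [h, h']; exact ⟨hp, hr⟩, hG.1.out1 x hx]
  · refine { hG.2 with out1 := ?_ }
    intro x hx y hy hxy
    rcases hmem y hy with ⟨h, -⟩ | hy
    exacts [absurd (hxy.symm.trans h) (hi.col1 x hx), hG.2.out1 x hx y hy hxy]
  · refine { hi with out1 := ?_ }
    intro x hx hxp
    rcases hmem x hx with ⟨-, h⟩ | hx
    exacts [h.le, (hi.out1 x hx hxp).trans (Nat.le_succ r)]
  · have : G.out1.val.map (fun x => msgA x.1 x.2.1 x.2.2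
        (if x.1 = p ∧ x.2.2 = r + 1 then W else G.W x.1 x.2.2)) =
        G.out1.val.map fun x => msgA x.1 x.2.1 x.2.2 (G.W x.1 x.2.2) := by
      refine Multiset.map_congr rfl fun x hx => ?_
      rw [if_neg]
      rintro ⟨h, h'⟩
      have := hi.out1 x hx h
      omega
    simp only [NFData.threads, agentThreads, Finset.disjUnion_val, Multiset.map_add, this,
      Finset.map_val, Multiset.map_map, castA]
    simp [hf, add_assoc]
  · intro q s hq h
    refine { h with out1 := ?_ }
    intro x hx hxq
    rcases hmem x hx with ⟨h', -⟩ | hx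
    exacts [absurd (hxq.symm.trans h') hq, h.out1 x hx hxq]

/-- Messages and collector are added at once because they share V²_p, which nothing uses as long as
p is idle. -/
theorem Good.add_phase2 (hG : G.Good Γ) (hi : G.Idle p r) (hp : Live Γ (.agent p)) (V M : Value)
    {k : ℕ} (hk : k ≤ n) :
    ∃ F : NFData n, F.Good Γ ∧ G.Adds F p (castB p V + {waitB p V M k}) := by
  obtain ⟨f, hf⟩ : ∃ f : Agent n ↪ Agent n × Agent n, ∀ i, f i = (p, i) :=
    ⟨⟨fun i => (p, i), fun i j h => by simpa using h⟩, fun _ => rfl⟩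
  have hd : Disjoint (Finset.univ.map f) G.out2 := by
    rw [Finset.disjoint_left]
    intro x hx hx'
    obtain ⟨i, -, rfl⟩ := Finset.mem_map.1 hx
    exact hi.out2 _ hx' (by rw [hf])
  have hmem : ∀ x ∈ (Finset.univ.map f).disjUnion G.out2 hd, x.1 = p ∨ x ∈ G.out2 := by
    intro x hx
    rcases Finset.mem_disjUnion.1 hx with hx | hx
    · obtain ⟨i, -, rfl⟩ := Finset.mem_map.1 hx
      simp [hf]
    · exact .inr hx
  have hne : ∀ q ∈ G.col2, q ≠ p := fun q hq h => hi.col2 (h ▸ hq)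
  refine ⟨{ G with
    out2 := (Finset.univ.map f).disjUnion G.out2 hd
    col2 := .cons p G.col2 hi.col2
    V2 := Function.update G.V2 p V
    M2 := Function.update G.M2 p M
    I2 := Function.update G.I2 p k }, ⟨?_, ?_⟩, ?_, ?_⟩
  · refine { hG.1 with out2 := ?_, col2 := ?_ }
    · intro x hx
      rcases hmem x hx with h | hx
      exacts [by rw [h]; exact hp, hG.1.out2 x hx]
    · intro q hq
      rcases (Finset.mem_cons (h := hi.col2)).1 hq with rfl | hq
      · simpa using ⟨hp, hk⟩
      · simpa [Function.update_of_ne (hne q hq)] using hG.1.col2 q hq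
  · refine { hG.2 with out2 := ?_, col2 := ?_, out3' := ?_ }
    · intro x hx y hy
      rcases hmem y hy with h | hy
      exacts [by rw [h]; exact (hi.col1 x hx).symm, hG.2.out2 x hx y hy]
    · intro x hx hx'
      rcases (Finset.mem_cons (h := hi.col2)).1 hx' with h | hx'
      exacts [hi.col1 x hx h, hG.2.col2 x hx hx']
    · intro q hq
      rcases (Finset.mem_cons (h := hi.col2)).1 hq with rfl | hq
      exacts [hi.out3, hG.2.out3' q hq]
  · have h₁ : G.out2.val.map (fun x => msgB x.1 x.2 (Function.update G.V2 p V x.1)) =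
        G.out2.val.map fun x => msgB x.1 x.2 (G.V2 x.1) :=
      Multiset.map_congr rfl fun x hx => by simp [Function.update_of_ne (hi.out2 x hx)]
    have h₂ : G.col2.val.map (fun q => waitB q (Function.update G.V2 p V q)
        (Function.update G.M2 p M q) (Function.update G.I2 p k q)) =
        G.col2.val.map fun q => waitB q (G.V2 q) (G.M2 q) (G.I2 q) :=
      Multiset.map_congr rfl fun q hq => by simp [Function.update_of_ne (hne q hq)]
    simp only [NFData.threads, agentThreads, Finset.disjUnion_val, Multiset.map_add, h₁, h₂,
      Finset.map_val, Multiset.map_map, castB, Finset.cons_val, Multiset.map_cons,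
      Function.update_self]
    simp only [hf, Function.comp_def, Function.update_self,
      ← Multiset.singleton_add]
    abel
  · intro q s hq h
    refine { h with out2 := ?_, col2 := fun hx => ?_ }
    · rcases (Finset.mem_cons (h := hi.col2)).1 hx with h' | hx
      exacts [hq h', h.col2 hx]
    · intro x hx
      rcases hmem x hx with h' | hx
      exacts [by rw [h']; exact hq.symm, h.out2 x hx]

/-- Resumes a collector of the second phase. V²_p must stay as it is, since messages of p carrying
it may still be pending. -/
theorem Good.add_waitB (hG : G.Good Γ) (hp : Live Γ (.agent p)) (h2 : p ∉ G.col2)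
    (h1 : ∀ x ∈ G.col1, x.1 ≠ p) (h3 : p ∉ G.out3) (M : Value) {k : ℕ} (hk : k ≤ n) :
    ∃ F : NFData n, F.Good Γ ∧ F.threads = {waitB p (G.V2 p) M k} + G.threads := by
  have hne : ∀ q ∈ G.col2, q ≠ p := fun q hq h => h2 (h ▸ hq)
  refine ⟨{ G with
    col2 := .cons p G.col2 h2
    M2 := Function.update G.M2 p M
    I2 := Function.update G.I2 p k }, ⟨?_, ?_⟩, ?_⟩
  · refine { hG.1 with col2 := ?_ }
    intro q hq
    rcases (Finset.mem_cons (h := h2)).1 hq with rfl | hq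
    · simpa using ⟨hp, hk⟩
    · simpa [Function.update_of_ne (hne q hq)] using hG.1.col2 q hq
  · refine { hG.2 with col2 := ?_, out3' := ?_ }
    · intro x hx hx'
      rcases (Finset.mem_cons (h := h2)).1 hx' with h | hx'
      exacts [h1 x hx h, hG.2.col2 x hx hx']
    · intro q hq
      rcases (Finset.mem_cons (h := h2)).1 hq with rfl | hq
      exacts [h3, hG.2.out3' q hq]
  · have : G.col2.val.map (fun q => waitB q (G.V2 q) (Function.update G.M2 p M q)
        (Function.update G.I2 p k q)) =
        G.col2.val.map fun q => waitB q (G.V2 q) (G.M2 q) (G.I2 q) :=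
      Multiset.map_congr rfl fun q hq => by simp [Function.update_of_ne (hne q hq)]
    simp only [NFData.threads, agentThreads, this, Finset.cons_val, Multiset.map_cons,
      Function.update_self, Multiset.singleton_add, Multiset.add_cons, Multiset.cons_add]

theorem Good.add_msgC (hG : G.Good Γ) (hp : Live Γ (.agent p)) (h2 : p ∉ G.col2)
    (h1 : ∀ x ∈ G.col1, x.1 ≠ p) (h3 : p ∉ G.out3) (V : Value) :
    ∃ F : NFData n, F.Good Γ ∧ F.threads = {msgC p V} + G.threads := by
  refine ⟨{ G with
    out3 := .cons p G.out3 h3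
    V3 := Function.update G.V3 p V }, ⟨?_, ?_⟩, ?_⟩
  · refine { hG.1 with out3 := ?_ }
    intro q hq
    rcases (Finset.mem_cons (h := h3)).1 hq with rfl | hq
    exacts [hp, hG.1.out3 q hq]
  · refine { hG.2 with out3 := ?_, out3' := ?_ }
    · intro x hx hx'
      rcases (Finset.mem_cons (h := h3)).1 hx' with h | hx'
      exacts [h1 x hx h, hG.2.out3 x hx hx']
    · intro q hq hq'
      rcases (Finset.mem_cons (h := h3)).1 hq' with rfl | hq'
      exacts [h2 hq, hG.2.out3' q hq hq']
  · have : G.out3.val.map (fun q => msgC q (Function.update G.V3 p V q)) =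
        G.out3.val.map fun q => msgC q (G.V3 q) :=
      Multiset.map_congr rfl fun q hq => by
        simp [Function.update_of_ne (fun h : q = p => h3 (h ▸ hq))]
    simp only [NFData.threads, agentThreads, this, Finset.cons_val, Multiset.map_cons,
      Function.update_self, Multiset.singleton_add, Multiset.add_cons, Multiset.cons_add]

theorem Adds.trans {G F F' : NFData n} {T T' : Multiset (Thread n)} (h : G.Adds F p T)
    (h' : F.Adds F' p T') : G.Adds F' p (T + T') where
  threads := by rw [h'.threads, h.threads, ← add_assoc, add_comm T]
  idle q r hq hr := h'.idle q r hq (h.idle q r hq hr)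

/-- In the first phase the broadcast comes first: it leaves p idle up to round r + 1, which is what
the collector of that round needs. -/
theorem Good.add_round (hn : 1 ≤ n) (hG : G.Good Γ) (hi : G.Idle p r) (hp : Live Γ (.agent p))
    (V W M : Value) :
    ∃ F : NFData n, F.Good Γ ∧ G.Adds F p (roundThreads p (r + 1) V W M) := by
  by_cases hr : r + 1 < n
  · obtain ⟨F, hF, hi, h⟩ := hG.add_castA hi hp hr W
    obtain ⟨F', hF', h'⟩ := hF.add_waitA hi hp hr V M hn
    exact ⟨F', hF', by rw [roundThreads, if_pos hr]; exact h.trans h'⟩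
  · rw [roundThreads, if_neg hr]
    exact hG.add_phase2 hi hp V M hn

/-! ### Transitions of normal forms -/

theorem mem_wrapThreads {j b : ℕ} {w : Value} {x : Thread n} (h : x ∈ wrapThreads n j w b) :
    wrapThreads n j w b = {x} ∧ (x = waitC n j w ∧ 1 ≤ j ∧ j ≤ n ∨
      x = (.wrap, .send chanOk (.val .bot)) ∨
      x = (.wrap, .call .WRAP (.tuple₃ (.nat j) (.val w) (.nat 0)))) := by
  unfold wrapThreads at h ⊢
  split_ifs at h ⊢ <;> simp_all

theorem fires_wrap {j b : ℕ} {w : Value} {x : Thread n} {Q : Net n}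
    (h : x ∈ wrapThreads n j w b) (hQ : Fires x Q) :
    ∃ j' w' b', Den Γ Q (wrapThreads n j' w' b') ∧
      ((j' ≤ n ∧ b' ∈ ({0, 1} : Set ℕ)) ∨ (j' = n + 1 ∧ b' = 1)) := by
  rcases (mem_wrapThreads h).2 with ⟨rfl, hj, hj'⟩ | rfl | rfl
  · obtain ⟨j', w', b', h, hb⟩ := fires_waitC (Γ := Γ) hQ
    refine ⟨j', w', b', h, ?_⟩
    simp only [Set.mem_insert_iff, Set.mem_singleton_iff]
    omega
  · rw [fires_send hQ]
    exact ⟨0, .bot, 1, by simpa [wrapThreads] using Den.nil, by simp⟩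
  · cases hQ

/-- An agent's firing thread is taken out of its index set. A message leaves nothing behind; a
collector leaves an agent in a position to receive the threads of its continuation. A wrapper thread
only changes the wrapper's parameters. -/
theorem Good.fires (hn : 1 ≤ n) {F : NFData n} (hF : F.Good Γ) {x : Thread n}
    {S₀ : Multiset (Thread n)} {Q : Net n} (hS : F.threads = x ::ₘ S₀) (hQ : Fires x Q) :
    ∃ T, Den Γ Q T ∧ ∃ F' : NFData n, F'.Good Γ ∧ F'.threads = T + S₀ := by
  have hx : x ∈ F.threads := hS ▸ Multiset.mem_cons_self x S₀
  have hval : ∀ {α : Type} [DecidableEq α] {s : Finset α} {a : α}, a ∈ s →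
      s.val = a ::ₘ (s.erase a).val := fun h => by
    rw [Finset.erase_val, Multiset.cons_erase h]
  -- Cancellation in multisets: it is irrelevant which index is taken to represent x.
  have rest : ∀ {G : NFData n}, F.threads = x ::ₘ G.threads → S₀ = G.threads := fun h => by
    rw [hS] at h
    exact (Multiset.cons_inj_right x).1 h
  have sent : ∀ {G : NFData n}, G.Good Γ → F.threads = x ::ₘ G.threads → Q = .nil →
      ∃ T, Den Γ Q T ∧ ∃ F' : NFData n, F'.Good Γ ∧ F'.threads = T + S₀ := by
    intro G hG h hQ
    rw [rest h, hQ]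
    exact ⟨0, .nil, G, hG, (zero_add _).symm⟩
  simp only [threads, agentThreads, Multiset.mem_add, Multiset.mem_map, Finset.mem_val] at hx
  rcases hx with ((((⟨y, hy, rfl⟩ | ⟨y, hy, rfl⟩) | ⟨p, hp, rfl⟩) | ⟨⟨p, r⟩, hy, rfl⟩) |
    ⟨p, hp, rfl⟩) | hx
  · refine sent (G := { F with out1 := F.out1.erase y })
      (hF.sub ⟨Finset.erase_subset _ _, le_rfl, le_rfl, le_rfl, le_rfl⟩ rfl rfl rfl rfl) ?_
      (fires_send hQ)
    simp only [threads, agentThreads, hval hy, Multiset.map_cons, Multiset.cons_add]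
  · refine sent (G := { F with out2 := F.out2.erase y })
      (hF.sub ⟨le_rfl, Finset.erase_subset _ _, le_rfl, le_rfl, le_rfl⟩ rfl rfl rfl rfl) ?_
      (fires_send hQ)
    simp only [threads, agentThreads, hval hy, Multiset.map_cons, Multiset.cons_add,
      Multiset.add_cons]
  · refine sent (G := { F with out3 := F.out3.erase p })
      (hF.sub ⟨le_rfl, le_rfl, Finset.erase_subset _ _, le_rfl, le_rfl⟩ rfl rfl rfl rfl) ?_
      (fires_send hQ)
    simp only [threads, agentThreads, hval hp, Multiset.map_cons, Multiset.cons_add,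
      Multiset.add_cons]
  · have hG : NFData.Good { F with col1 := F.col1.erase (p, r) } Γ :=
      hF.sub ⟨le_rfl, le_rfl, le_rfl, Finset.erase_subset _ _, le_rfl⟩ rfl rfl rfl rfl
    -- An agent collects in one round only, so without this collector p is idle, with messages
    -- pending up to round r at most.
    have hi : NFData.Idle { F with col1 := F.col1.erase (p, r) } p r := by
      refine ⟨fun z hz hzp => ?_, hF.2.col2 _ hy, hF.2.out1 _ hy, hF.2.out2 _ hy, hF.2.out3 _ hy⟩
      obtain ⟨hne, hz⟩ := Finset.mem_erase.1 hz
      exact hne (Prod.ext hzp (hF.2.round z hz _ hy hzp))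
    rw [rest (G := { F with col1 := F.col1.erase (p, r) }) (by
      simp only [threads, agentThreads, hval hy, Multiset.map_cons, Multiset.cons_add,
        Multiset.add_cons])]
    obtain ⟨hl, hr, hI⟩ := hF.1.col1 _ hy
    obtain ⟨e, M', rfl, he⟩ := fires_waitA hQ
    -- Either agent n was the last one awaited and the next round begins, or the collector goes on.
    rcases Nat.lt_or_ge n (F.I1 p + 1) with hk | hk
    · obtain ⟨F', hF', h⟩ := hG.add_round hn hi hl (updateK n (.num r) M' (F.V1 p))
        (updateR n (.num r) M' (F.V1 p)) M'
      exact ⟨_, .loc (runs_C1_next hn hl hk he), F', hF', h.threads⟩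
    · obtain ⟨F', hF', h⟩ := hG.add_waitA hi hl hr (F.V1 p) M' hk
      exact ⟨_, .loc (runs_C1_wait hl hk he), F', hF', h.threads⟩
  · have hG : NFData.Good { F with col2 := F.col2.erase p } Γ :=
      hF.sub ⟨le_rfl, le_rfl, le_rfl, le_rfl, Finset.erase_subset _ _⟩ rfl rfl rfl rfl
    have h1 : ∀ x ∈ F.col1, x.1 ≠ p := fun x hx h => hF.2.col2 x hx (h ▸ hp)
    rw [rest (G := { F with col2 := F.col2.erase p }) (by
      simp only [threads, agentThreads, hval hp, Multiset.map_cons, Multiset.cons_add,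
        Multiset.add_cons])]
    obtain ⟨hl, hI⟩ := hF.1.col2 _ hp
    obtain ⟨e, M', rfl, he⟩ := fires_waitB hQ
    have hrun := runs_C2 hl he
    have h2 : p ∉ F.col2.erase p := Finset.notMem_erase _ _
    split_ifs at hrun with hk
    · obtain ⟨F', hF', h⟩ := hG.add_waitB hl h2 h1 (hF.2.out3' p hp) M' hk
      exact ⟨_, .loc hrun, F', hF', h⟩
    · obtain ⟨F', hF', h⟩ := hG.add_msgC hl h2 h1 (hF.2.out3' p hp) _
      exact ⟨_, .loc hrun, F', hF', h⟩
  · obtain ⟨j, w, b, h, hw⟩ := fires_wrap (Γ := Γ) hx hQ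
    have hS' : S₀ = F.agentThreads := by
      have := hS
      rw [threads, (mem_wrapThreads hx).1, add_comm, Multiset.singleton_add] at this
      exact ((Multiset.cons_inj_right x).1 this).symm
    refine ⟨_, h, { F with wj := j, ww := w, wb := b }, ⟨{ hF.1 with wrap := hw }, ?_⟩, ?_⟩
    · exact hF.2.sub ⟨le_rfl, le_rfl, le_rfl, le_rfl, le_rfl⟩
    · rw [hS', add_comm]
      rfl

/-- A communication is treated as two firings in succession: the second thread is still present
after the first has fired. -/
theorem Good.active (hn : 1 ≤ n) {F : NFData n} (hF : F.Good Γ) {S₀ : Multiset (Thread n)}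
    {α : Act} {Q : Net n} (h : Active F.threads α Q S₀) :
    ∃ T, Den Γ Q T ∧ ∃ F' : NFData n, F'.Good Γ ∧ F'.threads = T + S₀ := by
  generalize hS : F.threads = S at h
  cases h with
  | one _ h => exact hF.fires hn hS h
  | two _ h h' =>
    obtain ⟨T, hT, F', hF', hS⟩ := hF.fires hn hS h
    rw [Multiset.add_cons] at hS
    obtain ⟨T', hT', F'', hF'', hS⟩ := hF'.fires hn hS h'
    exact ⟨T + T', .par hT hT', F'', hF'', by rw [hS, ← add_assoc, add_comm T']⟩

-- Crashes in normal forms.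

theorem survivors_map {α : Type} (s : Finset α) (f : α → Thread n) (q : α → Loc n)
    (h : ∀ x, (f x).1 = q x) [DecidablePred fun x => Live Γ (q x)] :
    survivors Γ (s.val.map f) = (s.filter fun x => Live Γ (q x)).val.map f := by
  classical
  rw [survivors, Multiset.filter_map, Finset.filter_val]
  congr 1
  exact Multiset.filter_congr fun x _ => by simp [h]

theorem survivors_wrapThreads (j b : ℕ) (w : Value) :
    survivors Γ (wrapThreads n j w b) = wrapThreads n j w b := by
  classical
  refine Multiset.filter_eq_self.2 fun x hx => ?_
  rcases (mem_wrapThreads hx).2 with ⟨rfl, -⟩ | rfl | rfl <;> trivial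

theorem Good.survivors {F : NFData n} (hF : F.Good Γ) (Γ' : Env n) :
    ∃ F' : NFData n, F'.Good Γ' ∧ F'.threads = survivors Γ' F.threads := by
  classical
  refine ⟨{ F with
    out1 := F.out1.filter fun x => Live Γ' (.agent x.1)
    out2 := F.out2.filter fun x => Live Γ' (.agent x.1)
    out3 := F.out3.filter fun p => Live Γ' (.agent p)
    col1 := F.col1.filter fun x => Live Γ' (.agent x.1)
    col2 := F.col2.filter fun p => Live Γ' (.agent p) }, ⟨?_, ?_⟩, ?_⟩
  · constructor
    · exact fun x hx => ⟨(Finset.mem_filter.1 hx).2, (hF.1.out1 x (Finset.mem_filter.1 hx).1).2⟩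
    · exact fun x hx => (Finset.mem_filter.1 hx).2
    · exact fun x hx => (Finset.mem_filter.1 hx).2
    · exact fun x hx => ⟨(Finset.mem_filter.1 hx).2, (hF.1.col1 x (Finset.mem_filter.1 hx).1).2⟩
    · exact fun x hx => ⟨(Finset.mem_filter.1 hx).2, (hF.1.col2 x (Finset.mem_filter.1 hx).1).2⟩
    · exact hF.1.wrap
  · exact hF.2.sub ⟨Finset.filter_subset _ _, Finset.filter_subset _ _, Finset.filter_subset _ _,
      Finset.filter_subset _ _, Finset.filter_subset _ _⟩
  · simp only [threads, agentThreads, survivors_add, survivors_wrapThreads]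
    rw [survivors_map F.out1 _ (fun x => .agent x.1) fun _ => rfl,
      survivors_map F.out2 _ (fun x => .agent x.1) fun _ => rfl,
      survivors_map F.out3 _ (fun x => .agent x) fun _ => rfl,
      survivors_map F.col1 _ (fun x => .agent x.1) fun _ => rfl,
      survivors_map F.col2 _ (fun x => .agent x) fun _ => rfl]

/-! ### The initial configuration -/

/-- The normal form without agents in which the wrapper is about to start. -/
def start (n : ℕ) : NFData n where
  out1 := ∅
  out2 := ∅
  out3 := ∅
  col1 := ∅
  col2 := ∅
  W _ _ := .bot
  V1 _ := .bot
  M1 _ := .bot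
  I1 _ := 0
  V2 _ := .bot
  M2 _ := .bot
  I2 _ := 0
  V3 _ := .bot
  wj := 1
  ww := .bot
  wb := 1

theorem good_start (hn : 1 ≤ n) : (start n).Good Γ := by
  refine ⟨⟨?_, ?_, ?_, ?_, ?_, .inl ⟨hn, by simp [start]⟩⟩, ⟨?_, ?_, ?_, ?_, ?_, ?_⟩⟩ <;>
    simp [start]

/-- Agents enter one at a time. Those still missing are idle up to round 0, so that entering is the
same as beginning round 0 + 1. -/
theorem exists_agents (hn : 1 ≤ n) (hΓ : ∀ p, Live Γ (.agent p)) (V W : Agent n → Value)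
    (M : Value) (L : List (Agent n)) (hL : L.Nodup) :
    ∃ F : NFData n, F.Good Γ ∧ (∀ p ∉ L, F.Idle p 0) ∧ ∃ T,
      Den Γ (.prod (L.map fun p => .loc (.agent p)
        (.call (.P1 p) (.tuple₄ (.nat 1) (.val (V p)) (.val (W p)) (.val M))))) T ∧
      F.threads = T + wrapThreads n 1 .bot 1 := by
  induction L with
  | nil =>
    refine ⟨start n, good_start hn, fun p _ => ⟨?_, ?_, ?_, ?_, ?_⟩, 0, .nil, ?_⟩ <;>
      simp [start, threads, agentThreads]
  | cons p L ih =>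
    obtain ⟨hp, hL⟩ := List.nodup_cons.1 hL
    obtain ⟨F, hF, hi, T, hT, h⟩ := ih hL
    obtain ⟨F', hF', h'⟩ := hF.add_round hn (hi p hp) (hΓ p) (V p) (W p) M
    refine ⟨F', hF', fun q hq => ?_, _, .par (.loc (runs_P1 hn (hΓ p) rfl)) hT, ?_⟩
    · rw [List.mem_cons, not_or] at hq
      exact h'.idle q 0 hq.1 (hi q hq.2)
    · rw [h'.threads, h, add_assoc]

end NFData

/-! ### Reachable configurations -/

/-- The threads of the configuration are those of an admissible normal form. -/
def HasNormalForm {n : ℕ} (C : Config n) : Prop :=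
  ∃ F : NFData n, F.Good C.env ∧ ResDen C.env (restricted n) C.net F.threads

variable {n : ℕ}

/-- Evaluation to threads does not refer to the immortal, so the invariant makes sense before the
choice, when `≡` cannot evaluate yet. -/
theorem hasNormalForm_initial (hn : 1 ≤ n) (U : Agent n → ℕ) : HasNormalForm (initial n U) := by
  obtain ⟨F, hF, -, T, hT, h⟩ := NFData.exists_agents (Γ := (initial n U).env) hn
    (fun p => Finset.mem_univ p) (fun p => initV p (U p)) (fun p => initW p (U p)) .empty
    (List.finRange n) (List.nodup_finRange n)
  refine ⟨F, hF, ?_⟩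
  rw [h]
  exact .resAll (.par hT (.loc (runs_WRAP rfl))) _

theorem HasNormalForm.step (hn : 1 ≤ n) {C C' : Config n} {α : Act} (hC : HasNormalForm C)
    (h : Step (defs n) C α C') : HasNormalForm C' := by
  obtain ⟨F, hF, hd⟩ := hC
  have he := h.effect _ _ hd
  clear h
  cases he with
  | choose _ h => exact ⟨F, hF, h⟩
  | crash _ _ _ h =>
    obtain ⟨F', hF', e⟩ := hF.survivors _
    exact ⟨F', hF', by rw [e]; exact h⟩
  | act ha h =>
    obtain ⟨T, hT, F', hF', e⟩ := hF.active hn ha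
    exact ⟨F', hF', by rw [e]; exact h T hT⟩

theorem HasNormalForm.weakTau (hn : 1 ≤ n) {C C' : Config n} (hC : HasNormalForm C)
    (h : WeakTau (defs n) C C') : HasNormalForm C' := by
  induction h with
  | refl => exact hC
  | tail _ h ih => exact ih.step hn h

theorem HasNormalForm.weakSeq (hn : 1 ≤ n) {σ : List Act} {C C' : Config n}
    (hC : HasNormalForm C) (h : WeakSeq (defs n) σ C C') : HasNormalForm C' := by
  induction σ generalizing C with
  | nil => exact hC.weakTau hn h
  | cons α σ ih =>
    obtain ⟨C₁, h₁, h⟩ := h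
    refine ih ?_ h
    rcases h₁ with ⟨-, h₁⟩ | ⟨-, C₂, C₃, h₁, h₂, h₃⟩
    · exact hC.weakTau hn h₁
    · exact ((hC.weakTau hn h₁).step hn h₂).weakTau hn h₃

end ConsensusCalculus

theorem mainTheorem6 (n : ℕ) (hn : 1 ≤ n) (C : ConsensusCalculus.Config n)
    (hC : ConsensusCalculus.Reachable n C) :
    ∃ N : ConsensusCalculus.Config n, ConsensusCalculus.IsNormalFormOf N C := by
  obtain ⟨ht, U, σ, -, h⟩ := hC
  obtain ⟨F, hF, hd⟩ := (ConsensusCalculus.hasNormalForm_initial hn U).weakSeq hn h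
  -- Both networks evaluate to `F.threads` below the same restrictions, hence are congruent to the
  -- same product of threads.
  exact ⟨⟨C.env, C.immortal, F.net⟩,
    ⟨rfl, rfl, (hF.1.resDen_net.netCong ht).trans (hd.netCong ht).symm⟩, F, hF.1, rfl⟩
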